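/- All rings are associative and unital, not necessarily commutative. Let $S\to R$ be a ring extension, i.e. a (unital, not necessarily injective) ring homomorphism. An \emph{$S$-relative differential graded ring} is an $\mathbb N$-graded ring $\Omega=\bigoplus_{n\ge 0}\Omega^n$ with an additive map $d:\Omega^{\bullet}\to\Omega^{\bullet+1}$ such that $d\circ d=0$ and $d(\omega\omega')=d(\omega)\omega'+(-1)^n\omega\, d(\omega')$ for $\omega\in\Omega^n$, $\omega'\in\Omega$, together with a ring map $S\to\Omega^0$ such that $d$ vanishes on the image of $S$ (so that $d$ is an $(S,S)$-bimodule map). Isomorphisms are isomorphisms of graded rings commuting with $d$ and with the maps from $S$. Let ${\mathfrak C}=R\otimes_S R$ be the canonical Sweedler $R$-coring, with coproduct $\Delta(r\otimes_S r')=(r\otimes_S 1_R)\otimes_R(1_R\otimes_S r')$ and counit $\epsilon(r\otimes_S r')=rr'$, and let $g=1_R\otimes_S 1_R$. Let $\Omega({\mathfrak C}/S)$ be the ring of ${\mathfrak C}$-valued differential forms on $R$: it is the tensor ring of the $(R,R)$-bimodule $\ker\epsilon$, so $\Omega^0({\mathfrak C}/S)=R$ and $\Omega^n({\mathfrak C}/S)=(\ker\epsilon)^{\otimes_R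 n}$, and its differential is the restriction of the Amitsur differential of the tensor ring of ${\mathfrak C}$, given by $d(r)=gr-rg$ and $$d(c^1\otimes_R\cdots\otimes_R c^n)=g\otimes_R c^1\otimes_R\cdots\otimes_R c^n+\sum_{i=1}^n(-1)^i c^1\otimes_R\cdots\otimes_R\Delta(c^i)\otimes_R\cdots\otimes_R c^n+(-1)^{n+1}c^1\otimes_R\cdots\otimes_R c^n\otimes_R g .$$ Let $\pi:R\to R/S$ be the cokernel of $S\to R$, an $(S,S)$-bimodule map, and let $\Omega_SR$ be the (Cuntz--Quillen) algebra of $S$-relative differential forms: $\Omega^n_SR=R\otimes_S(R/S)^{\otimes_S n}$, and, writing $(r_0,r_1,\ldots,r_n)=r_0\otimes_S\pi(r_1)\otimes_S\cdots\otimes_S\pi(r_n)$ for $r_i\in R$, $$(r_0,\ldots,r_n)(r_{n+1},\ldots,r_m)=\sum_{i=0}^n(-1)^{n-i}(r_0,\ldots,r_{i-1},r_ir_{i+1},r_{i+2},\ldots,r_m),\qquad d(r_0,\ldots,r_n)=(1_R,r_0,\ldots,r_n).$$ In both cases $S$ maps to the degree-zero component $R$ by the given map $S\to R$. Then $\Omega({\mathfrak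 C}/S)$ and $\Omega_SR$ are isomorphic as $S$-relative differential graded rings. -/

import Mathlib

open MulOpposite (op)

noncomputable section

namespace CoringForms

universe u v w

open scoped DirectSum

/-! ### Tensor products over a noncommutative ring -/

section Tensor

open scoped TensorProduct

/-- The tensor product `M ⊗_R N` of a right module and a left module over a ring `R`:
the quotient of `M ⊗_ℤ N` by the relations `m r ⊗ n = m ⊗ r n`. Right `R`-modules are
modules over `Rᵐᵒᵖ`, the product `m r` being `op r • m`. -/
def BalTensor (R : Type*) (M N : Type*) [Ring R] [AddCommGroup M] [Module Rᵐᵒᵖ M]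
    [AddCommGroup N] [Module R N] : Type _ :=
  (M ⊗[ℤ] N) ⧸ (Submodule.span ℤ
    {z : M ⊗[ℤ] N | ∃ (m : M) (r : R) (n : N), z = (op r • m) ⊗ₜ[ℤ] n - m ⊗ₜ[ℤ] (r • n)})

variable {R : Type*} {M N P : Type*} [Ring R] [AddCommGroup M] [Module Rᵐᵒᵖ M]
    [AddCommGroup N] [Module R N] [AddCommGroup P]

instance BalTensor.instAddCommGroup : AddCommGroup (BalTensor R M N) := by
  unfold BalTensor; infer_instance

namespace BalTensor

/-- The class of `m ⊗ n` in `M ⊗_R N`, as a biadditive map. -/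
def mk (R : Type*) {M N : Type*} [Ring R] [AddCommGroup M] [Module Rᵐᵒᵖ M]
    [AddCommGroup N] [Module R N] : M →+ N →+ BalTensor R M N :=
  AddMonoidHom.mk' (fun m => AddMonoidHom.mk' (fun n => Submodule.Quotient.mk (m ⊗ₜ[ℤ] n))
    (fun a b => by rw [TensorProduct.tmul_add]; rfl))
    (fun a b => by ext n; simp only [TensorProduct.add_tmul]; rfl)

theorem mk_smul (m : M) (r : R) (n : N) : mk R (op r • m) n = mk R m (r • n) :=
  (Submodule.Quotient.eq _).2 (Submodule.subset_span ⟨m, r, n, rfl⟩)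

/-- The universal property: a balanced biadditive map factors through `M ⊗_R N`. -/
def lift (f : M →+ N →+ P) (hf : ∀ m (r : R) n, f (op r • m) n = f m (r • n)) :
    BalTensor R M N →+ P :=
  (Submodule.liftQ _ (TensorProduct.liftAddHom (R := ℤ) f
      (fun r m n => by simp only [map_zsmul, AddMonoidHom.zsmul_apply])).toIntLinearMap (by
    rw [Submodule.span_le]
    rintro _ ⟨m, r, n, rfl⟩
    simp [hf])).toAddMonoidHom

@[simp] theorem lift_mk (f : M →+ N →+ P) (hf : ∀ m (r : R) n, f (op r • m) n = f m (r • n))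
    (m : M) (n : N) : lift f hf (mk R m n) = f m n := rfl

@[elab_as_elim]
theorem induction {p : BalTensor R M N → Prop} (z : BalTensor R M N)
    (tmul : ∀ m n, p (mk R m n)) (add : ∀ x y, p x → p y → p (x + y)) : p z := by
  obtain ⟨z, rfl⟩ := Submodule.Quotient.mk_surjective _ z
  induction z using TensorProduct.induction_on with
  | zero =>
    have h := tmul 0 0
    rw [map_zero] at h
    exact h
  | tmul m n => exact tmul m n
  | add x y hx hy => exact add _ _ hx hy

theorem hom_ext {f g : BalTensor R M N →+ P} (h : ∀ m n, f (mk R m n) = g (mk R m n)) :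
    f = g := by
  ext z
  induction z using induction with
  | tmul m n => exact h m n
  | add x y hx hy => rw [map_add, map_add, hx, hy]

/-- The map `f ⊗ g` induced by a right linear map `f` and a left linear map `g`. -/
def map {M' N' : Type*} [AddCommGroup M'] [Module Rᵐᵒᵖ M'] [AddCommGroup N'] [Module R N']
    (f : M →+ M') (hf : ∀ (r : R) m, f (op r • m) = op r • f m)
    (g : N →+ N') (hg : ∀ (r : R) n, g (r • n) = r • g n) :
    BalTensor R M N →+ BalTensor R M' N' :=
  lift (((mk R).compl₂ g).comp f) (fun m r n => by simp [hf, hg, mk_smul])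

@[simp] theorem map_mk {M' N' : Type*} [AddCommGroup M'] [Module Rᵐᵒᵖ M'] [AddCommGroup N']
    [Module R N'] (f : M →+ M') (hf : ∀ (r : R) m, f (op r • m) = op r • f m)
    (g : N →+ N') (hg : ∀ (r : R) n, g (r • n) = r • g n) (m : M) (n : N) :
    map f hf g hg (mk R m n) = mk R (f m) (g n) := rfl

end BalTensor

end Tensor

/-! ### Bimodules -/

/-- An `(A, B)`-bimodule. -/
structure Bimod (A : Type u) (B : Type v) [Ring A] [Ring B] where
  carrier : Type w
  [addCommGroup : AddCommGroup carrier]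
  [left : Module A carrier]
  [right : Module Bᵐᵒᵖ carrier]
  [comm : SMulCommClass A Bᵐᵒᵖ carrier]

attribute [instance] Bimod.addCommGroup Bimod.left Bimod.right Bimod.comm

instance {A : Type u} {B : Type v} [Ring A] [Ring B] :
    CoeSort (Bimod.{u, v, w} A B) (Type w) := ⟨Bimod.carrier⟩

/-- A homomorphism of bimodules. -/
structure BimodHom {A B : Type*} [Ring A] [Ring B] (X Y : Bimod A B) extends X →+ Y where
  map_left : ∀ (a : A) (x : X), toFun (a • x) = a • toFun x
  map_right : ∀ (b : B) (x : X), toFun (op b • x) = op b • toFun x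

instance {A B : Type*} [Ring A] [Ring B] (X Y : Bimod A B) : FunLike (BimodHom X Y) X Y where
  coe f := f.toFun
  coe_injective f g h := by
    cases f; cases g; congr; exact DFunLike.coe_injective h

instance {A B : Type*} [Ring A] [Ring B] (X Y : Bimod A B) :
    AddMonoidHomClass (BimodHom X Y) X Y where
  map_add f := f.map_add'
  map_zero f := f.map_zero'

section

variable {A B : Type*} [Ring A] [Ring B] {X Y : Bimod A B}

theorem BimodHom.left (f : BimodHom X Y) (a : A) (x : X) : f (a • x) = a • f x := f.map_left a x

theorem BimodHom.right (f : BimodHom X Y) (b : B) (x : X) : f (op b • x) = op b • f x :=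
  f.map_right b x

@[simp] theorem BimodHom.toAddMonoidHom_apply (f : BimodHom X Y) (x : X) :
    f.toAddMonoidHom x = f x := rfl

end

namespace Bimod

variable {A B R : Type*} [Ring A] [Ring B] [Ring R]

/-- The ring `R` as an `(R, R)`-bimodule. -/
def regular (R : Type u) [Ring R] : Bimod.{u, u, u} R R where
  carrier := R

/-- Multiplication by a scalar from the left on the tensor product of bimodules. -/
def smulLeft (X : Bimod A R) (Y : Bimod R B) (a : A) : BalTensor R X Y →+ BalTensor R X Y :=
  BalTensor.map (DistribSMul.toAddMonoidHom X a) (fun r m => smul_comm a (op r) m)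
    (AddMonoidHom.id Y) (fun _ _ => rfl)

/-- Multiplication by a scalar from the right on the tensor product of bimodules. -/
def smulRight (X : Bimod A R) (Y : Bimod R B) (b : Bᵐᵒᵖ) :
    BalTensor R X Y →+ BalTensor R X Y :=
  BalTensor.map (AddMonoidHom.id X) (fun _ _ => rfl)
    (DistribSMul.toAddMonoidHom Y b) (fun r m => (smul_comm r b m).symm)

theorem smulLeft_mk (X : Bimod A R) (Y : Bimod R B) (a : A) (m : X) (n : Y) :
    smulLeft X Y a (BalTensor.mk R m n) = BalTensor.mk R (a • m) n := rfl

theorem smulRight_mk (X : Bimod A R) (Y : Bimod R B) (b : Bᵐᵒᵖ) (m : X) (n : Y) :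
    smulRight X Y b (BalTensor.mk R m n) = BalTensor.mk R m (b • n) := rfl

/-- The tensor product of an `(A, R)`-bimodule and an `(R, B)`-bimodule, an `(A, B)`-bimodule. -/
def tensor (X : Bimod A R) (Y : Bimod R B) : Bimod A B :=
  letI l : Module A (BalTensor R X Y) :=
    { smul := fun a z => smulLeft X Y a z
      one_smul := fun z => DFunLike.congr_fun (f := smulLeft X Y 1) (g := AddMonoidHom.id _)
        (BalTensor.hom_ext fun m n => by simp [smulLeft_mk]) z
      mul_smul := fun a b z => DFunLike.congr_fun (f := smulLeft X Y (a * b))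
        (g := (smulLeft X Y a).comp (smulLeft X Y b))
        (BalTensor.hom_ext fun m n => by simp [smulLeft_mk, mul_smul]) z
      smul_zero := fun a => map_zero (smulLeft X Y a)
      smul_add := fun a => map_add (smulLeft X Y a)
      add_smul := fun a b z => DFunLike.congr_fun (f := smulLeft X Y (a + b))
        (g := smulLeft X Y a + smulLeft X Y b)
        (BalTensor.hom_ext fun m n => by simp [smulLeft_mk, add_smul]) z
      zero_smul := fun z => DFunLike.congr_fun (f := smulLeft X Y 0) (g := 0)
        (BalTensor.hom_ext fun m n => by simp [smulLeft_mk]) z }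
  letI r : Module Bᵐᵒᵖ (BalTensor R X Y) :=
    { smul := fun a z => smulRight X Y a z
      one_smul := fun z => DFunLike.congr_fun (f := smulRight X Y 1) (g := AddMonoidHom.id _)
        (BalTensor.hom_ext fun m n => by simp [smulRight_mk]) z
      mul_smul := fun a b z => DFunLike.congr_fun (f := smulRight X Y (a * b))
        (g := (smulRight X Y a).comp (smulRight X Y b))
        (BalTensor.hom_ext fun m n => by simp [smulRight_mk, mul_smul]) z
      smul_zero := fun a => map_zero (smulRight X Y a)
      smul_add := fun a => map_add (smulRight X Y a)
      add_smul := fun a b z => DFunLike.congr_fun (f := smulRight X Y (a + b))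
        (g := smulRight X Y a + smulRight X Y b)
        (BalTensor.hom_ext fun m n => by simp [smulRight_mk, add_smul]) z
      zero_smul := fun z => DFunLike.congr_fun (f := smulRight X Y 0) (g := 0)
        (BalTensor.hom_ext fun m n => by simp [smulRight_mk]) z }
  { carrier := BalTensor R X Y
    left := l
    right := r
    comm := ⟨fun a b z => DFunLike.congr_fun (f := (smulLeft X Y a).comp (smulRight X Y b))
        (g := (smulRight X Y b).comp (smulLeft X Y a))
        (BalTensor.hom_ext fun m n => by simp [smulLeft_mk, smulRight_mk]) z⟩ }

/-- The pure tensor `x ⊗ y`, biadditive in `x` and `y`. -/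
def tmul (X : Bimod A R) (Y : Bimod R B) : X →+ Y →+ tensor X Y := BalTensor.mk R

variable {X : Bimod A R} {Y : Bimod R B}

theorem tmul_smul (x : X) (r : R) (y : Y) : tmul X Y (op r • x) y = tmul X Y x (r • y) :=
  BalTensor.mk_smul x r y

theorem left_tmul (a : A) (x : X) (y : Y) : a • tmul X Y x y = tmul X Y (a • x) y := rfl

theorem right_tmul (b : B) (x : X) (y : Y) : op b • tmul X Y x y = tmul X Y x (op b • y) := rfl

/-- The additive map out of `X ⊗ Y` given by a balanced biadditive map. -/
def lift {P : Type*} [AddCommGroup P] (f : X →+ Y →+ P)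
    (hf : ∀ x (r : R) y, f (op r • x) y = f x (r • y)) : tensor X Y →+ P := BalTensor.lift f hf

@[simp] theorem lift_tmul {P : Type*} [AddCommGroup P] (f : X →+ Y →+ P)
    (hf : ∀ x (r : R) y, f (op r • x) y = f x (r • y)) (x : X) (y : Y) :
    lift f hf (tmul X Y x y) = f x y := rfl

@[elab_as_elim]
theorem tensor_induction {p : tensor X Y → Prop} (z : tensor X Y)
    (tmul : ∀ x y, p (tmul X Y x y)) (add : ∀ x y, p x → p y → p (x + y)) : p z :=
  BalTensor.induction z tmul add

theorem tensor_ext {P : Type*} [AddCommGroup P] {f g : tensor X Y →+ P}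
    (h : ∀ x y, f (tmul X Y x y) = g (tmul X Y x y)) : f = g := BalTensor.hom_ext h

/-- The additive map `f ⊗ g` for a right linear `f` and a left linear `g`. -/
def map {A' B' : Type*} [Ring A'] [Ring B'] {X' : Bimod A' R} {Y' : Bimod R B'}
    (f : X →+ X') (hf : ∀ (r : R) x, f (op r • x) = op r • f x)
    (g : Y →+ Y') (hg : ∀ (r : R) y, g (r • y) = r • g y) : tensor X Y →+ tensor X' Y' :=
  BalTensor.map f hf g hg

@[simp] theorem map_tmul {A' B' : Type*} [Ring A'] [Ring B'] {X' : Bimod A' R} {Y' : Bimod R B'}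
    (f : X →+ X') (hf : ∀ (r : R) x, f (op r • x) = op r • f x)
    (g : Y →+ Y') (hg : ∀ (r : R) y, g (r • y) = r • g y) (x : X) (y : Y) :
    map f hf g hg (tmul X Y x y) = tmul X' Y' (f x) (g y) := rfl

/-- The tensor product of two bimodule homomorphisms. -/
def mapHom {X' : Bimod A R} {Y' : Bimod R B} (f : BimodHom X X') (g : BimodHom Y Y') :
    BimodHom (tensor X Y) (tensor X' Y') where
  toAddMonoidHom := map f.toAddMonoidHom f.map_right g.toAddMonoidHom g.map_left
  map_left a z := by
    change map _ _ _ _ (a • z) = a • map _ _ _ _ z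
    induction z using tensor_induction with
    | tmul x y => exact congrArg (fun t => tmul X' Y' t (g y)) (f.left a x)
    | add x y hx hy => rw [smul_add, map_add, map_add, hx, hy, smul_add]
  map_right b z := by
    change map _ _ _ _ (op b • z) = op b • map _ _ _ _ z
    induction z using tensor_induction with
    | tmul x y => exact congrArg (fun t => tmul X' Y' (f x) t) (g.right b y)
    | add x y hx hy => rw [smul_add, map_add, map_add, hx, hy, smul_add]

@[simp] theorem mapHom_tmul {X' : Bimod A R} {Y' : Bimod R B} (f : BimodHom X X')
    (g : BimodHom Y Y') (x : X) (y : Y) :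
    mapHom f g (tmul X Y x y) = tmul X' Y' (f x) (g y) := rfl

/-- The associativity map `(X ⊗ Y) ⊗ Z → X ⊗ (Y ⊗ Z)`. -/
def assoc {R' : Type*} [Ring R'] (X : Bimod A R) (Y : Bimod R R') (Z : Bimod R' B) :
    tensor (tensor X Y) Z →+ tensor X (tensor Y Z) :=
  lift (lift (AddMonoidHom.mk' (fun x => (AddMonoidHom.compHom (tmul X (tensor Y Z) x)).comp
        (tmul Y Z)) (fun x y => by ext a b; simp))
      (fun x r y => by ext z; exact tmul_smul x r (tmul Y Z y z)))
    (fun t r z => by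
      induction t using tensor_induction with
      | tmul x y => exact congrArg (tmul X (tensor Y Z) x) (tmul_smul y r z)
      | add s t hs ht => simp only [smul_add, map_add, AddMonoidHom.add_apply, hs, ht])

@[simp] theorem assoc_tmul {R' : Type*} [Ring R'] (X : Bimod A R) (Y : Bimod R R')
    (Z : Bimod R' B) (x : X) (y : Y) (z : Z) :
    assoc X Y Z (tmul (tensor X Y) Z (tmul X Y x y) z) =
      tmul X (tensor Y Z) x (tmul Y Z y z) := rfl

/-- The left multiplication `(r, y) ↦ r y` of a bimodule. -/
def lmul (Y : Bimod R B) : R →+ Y →+ Y :=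
  AddMonoidHom.mk' (fun r => DistribSMul.toAddMonoidHom Y r)
    (fun r s => AddMonoidHom.ext fun y => add_smul r s y)

/-- The right multiplication `(x, r) ↦ x r` of a bimodule. -/
def rmul (X : Bimod A R) : X →+ R →+ X :=
  AddMonoidHom.mk' (fun x => AddMonoidHom.mk' (fun r => op r • x)
    (fun r s => by rw [MulOpposite.op_add, add_smul]))
    (fun x y => AddMonoidHom.ext fun r => smul_add (op r) x y)

@[simp] theorem lmul_apply (r : R) (y : Y) : lmul Y r y = r • y := rfl

@[simp] theorem rmul_apply (x : X) (r : R) : rmul X x r = op r • x := rfl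

theorem op_op_smul (x : X) (r s : R) : op s • op r • x = op (r * s) • x := by
  rw [MulOpposite.op_mul, mul_smul]

/-- The map `R ⊗_R Y → Y`, `r ⊗ y ↦ r y`. -/
def lid (Y : Bimod R B) : tensor (regular R) Y →+ Y :=
  lift (X := regular R) (lmul Y) (fun r s y => mul_smul (show R from r) s y)

@[simp] theorem lid_tmul (Y : Bimod R B) (r : R) (y : Y) :
    lid Y (tmul (regular R) Y r y) = r • y := rfl

/-- The map `X ⊗_R R → X`, `x ⊗ r ↦ x r`. -/
def rid (X : Bimod A R) : tensor X (regular R) →+ X :=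
  lift (Y := regular R) (rmul X) (fun x r s => op_op_smul x r (show R from s))

@[simp] theorem rid_tmul (X : Bimod A R) (x : X) (r : R) :
    rid X (tmul X (regular R) x r) = op r • x := rfl

/-- The identity homomorphism. -/
def idHom (X : Bimod A B) : BimodHom X X := ⟨AddMonoidHom.id X, fun _ _ => rfl, fun _ _ => rfl⟩

@[simp] theorem idHom_apply (X : Bimod A B) (x : X) : idHom X x = x := rfl

end Bimod

/-! ### Graded rings and relative differential graded rings -/

/-- Transport along an equality of degrees. -/
def gcast {A : ℕ → Type u} [∀ n, AddCommGroup (A n)] {m n : ℕ} (h : m = n) : A m →+ A n :=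
  h ▸ AddMonoidHom.id (A m)

@[simp] theorem gcast_rfl {A : ℕ → Type u} [∀ n, AddCommGroup (A n)] {n : ℕ} (h : n = n)
    (x : A n) : gcast h x = x := rfl

theorem mk_eq_of_gcast {A : ℕ → Type u} [∀ n, AddCommGroup (A n)] {m n : ℕ} (h : m = n)
    {x : A m} {y : A n} (e : gcast h x = y) : GradedMonoid.mk m x = GradedMonoid.mk n y := by
  subst h; subst e; rfl

theorem of_gcast {A : ℕ → Type u} [∀ n, AddCommGroup (A n)] {m n : ℕ} (h : m = n) (x : A m) :
    DirectSum.of A n (gcast h x) = DirectSum.of A m x := by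
  subst h; rfl

/-- An `ℕ`-graded ring from a biadditive multiplication on its components. -/
@[reducible] def gringMk {A : ℕ → Type u} [∀ n, AddCommGroup (A n)]
    (mul : ∀ m n, A m →+ A n →+ A (m + n)) (one : A 0)
    (one_mul : ∀ n (x : A n), gcast (Nat.zero_add n) (mul 0 n one x) = x)
    (mul_one : ∀ n (x : A n), mul n 0 x one = x)
    (assoc : ∀ l m n (x : A l) (y : A m) (z : A n),
      gcast (Nat.add_assoc l m n) (mul _ _ (mul _ _ x y) z) = mul _ _ x (mul _ _ y z)) :
    DirectSum.GRing A :=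
  letI gmul : GradedMonoid.GMul A := ⟨fun {m n} x y => mul m n x y⟩
  letI gone : GradedMonoid.GOne A := ⟨one⟩
  letI gmonoid : GradedMonoid.GMonoid A :=
    { gmul, gone with
      one_mul := fun ⟨n, x⟩ => mk_eq_of_gcast _ (one_mul n x)
      mul_one := fun ⟨n, x⟩ => mk_eq_of_gcast rfl (mul_one n x)
      mul_assoc := fun ⟨l, x⟩ ⟨m, y⟩ ⟨n, z⟩ => mk_eq_of_gcast _ (assoc l m n x y z) }
  { gmonoid with
    mul_zero := fun x => map_zero _
    zero_mul := fun y => by change mul _ _ 0 y = 0; rw [map_zero]; rfl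
    mul_add := fun x y z => map_add _ _ _
    add_mul := fun x y z => by
      change mul _ _ (x + y) z = mul _ _ x z + mul _ _ y z; rw [map_add]; rfl
    natCast := fun k => k • one
    natCast_zero := zero_smul _ _
    natCast_succ := fun k => by rw [add_smul, one_smul]; rfl
    intCast := fun k => k • one
    intCast_ofNat := fun k => natCast_zsmul _ _
    intCast_negSucc_ofNat := fun k => negSucc_zsmul _ _ }

/-- An `S`-relative differential graded ring (a differential graded algebra over the ring `S`):
an `ℕ`-graded ring `Ω = ⨁ Ωⁿ` with an additive map `d : Ωⁿ → Ωⁿ⁺¹` such that `d ∘ d = 0`,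
satisfying the graded Leibniz rule, and a ring map `η : S → Ω⁰` with `d (η s) = 0`. By the
Leibniz rule `d` is then a map of `(S, S)`-bimodules, see `RelDGRing.D_left` and
`RelDGRing.D_right`. -/
structure RelDGRing (S : Type v) [Ring S] where
  Ω : ℕ → Type u
  [addCommGroup : ∀ n, AddCommGroup (Ω n)]
  [gring : DirectSum.GRing Ω]
  d : ∀ n, Ω n →+ Ω (n + 1)
  d_d : ∀ n (x : Ω n), d (n + 1) (d n x) = 0
  leibniz : ∀ m n (x : Ω m) (y : Ω n),
    DirectSum.of Ω (m + n + 1) (d (m + n) (GradedMonoid.GMul.mul x y)) =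
      DirectSum.of Ω (m + 1) (d m x) * DirectSum.of Ω n y +
        (-1) ^ m * (DirectSum.of Ω m x * DirectSum.of Ω (n + 1) (d n y))
  η : S →+* Ω 0
  d_η : ∀ s, d 0 (η s) = 0

namespace RelDGRing

attribute [instance] RelDGRing.addCommGroup RelDGRing.gring

variable {S : Type v} [Ring S] (A : RelDGRing.{u, v} S)


/-- The differential on the ring `⨁ Ωⁿ`. -/
def D : (⨁ n, A.Ω n) →+ ⨁ n, A.Ω n :=
  DirectSum.toAddMonoid fun n => (DirectSum.of A.Ω (n + 1)).comp (A.d n)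

theorem D_of (n : ℕ) (x : A.Ω n) :
    A.D (DirectSum.of A.Ω n x) = DirectSum.of A.Ω (n + 1) (A.d n x) := by
  simp [D]

theorem D_mul (m : ℕ) (x : A.Ω m) (ω : ⨁ n, A.Ω n) :
    A.D (DirectSum.of A.Ω m x * ω) =
      A.D (DirectSum.of A.Ω m x) * ω + (-1) ^ m * (DirectSum.of A.Ω m x * A.D ω) := by
  induction ω using DirectSum.induction_on with
  | zero => simp
  | of n y => rw [DirectSum.of_mul_of, D_of, D_of, D_of, A.leibniz]
  | add y z hy hz => simp only [mul_add, map_add, hy, hz]; abel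

theorem D_left (s : S) (ω : ⨁ n, A.Ω n) :
    A.D (DirectSum.of A.Ω 0 (A.η s) * ω) = DirectSum.of A.Ω 0 (A.η s) * A.D ω := by
  rw [D_mul, D_of, A.d_η]; simp

theorem D_right (s : S) (ω : ⨁ n, A.Ω n) :
    A.D (ω * DirectSum.of A.Ω 0 (A.η s)) = A.D ω * DirectSum.of A.Ω 0 (A.η s) := by
  induction ω using DirectSum.induction_on with
  | zero => simp
  | of n y => rw [D_mul, D_of _ 0, A.d_η]; simp
  | add y z hy hz => simp only [add_mul, map_add, hy, hz]

/-- An isomorphism of `S`-relative differential graded rings: additive bijections in each degree,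
respecting products, the unit, the differentials and the maps from `S`. -/
structure Iso (A : RelDGRing.{u, v} S) (B : RelDGRing.{w, v} S) where
  equiv : ∀ n, A.Ω n ≃+ B.Ω n
  map_mul : ∀ m n (x : A.Ω m) (y : A.Ω n),
    equiv (m + n) (GradedMonoid.GMul.mul x y) = GradedMonoid.GMul.mul (equiv m x) (equiv n y)
  map_one : equiv 0 GradedMonoid.GOne.one = GradedMonoid.GOne.one
  map_d : ∀ n (x : A.Ω n), equiv (n + 1) (A.d n x) = B.d n (equiv n x)
  map_η : ∀ s, equiv 0 (A.η s) = B.η s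

end RelDGRing

/-! ### The tensor ring of a bimodule -/

section TensorRing

variable {R : Type u} [Ring R]

/-- The component `R ⊗_R M ⊗_R ⋯ ⊗_R M` (`n` factors `M`) of the tensor ring of the bimodule `M`;
the leading factor `R` gives `R` itself for `n = 0` and only matters up to the canonical
isomorphism `R ⊗_R M = M` for `n > 0`. -/
def tpow (M : Bimod.{u, u, u} R R) : ℕ → Bimod.{u, u, u} R R
  | 0 => Bimod.regular R
  | n + 1 => Bimod.tensor (tpow M n) M

variable (M : Bimod.{u, u, u} R R)

/-- An element of `R` in degree zero. -/
def unitR : R →+ tpow M 0 := AddMonoidHom.id R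

/-- `snoc x c` is `x ⊗ c`. -/
def snoc (n : ℕ) : tpow M n →+ M →+ tpow M (n + 1) := Bimod.tmul (tpow M n) M

variable {M}

theorem snoc_smul {n : ℕ} (x : tpow M n) (r : R) (c : M) :
    snoc M n (op r • x) c = snoc M n x (r • c) := Bimod.tmul_smul x r c

theorem left_snoc {n : ℕ} (r : R) (x : tpow M n) (c : M) :
    r • snoc M n x c = snoc M n (r • x) c := rfl

theorem right_snoc {n : ℕ} (r : R) (x : tpow M n) (c : M) :
    op r • snoc M n x c = snoc M n x (op r • c) := rfl

theorem left_unitR (r s : R) : r • unitR M s = unitR M (r * s) := rfl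

theorem right_unitR (r s : R) : op r • unitR M s = unitR M (s * r) := rfl

/-- Maps out of `tpow M (n + 1)`. -/
def snocLift {P : Type*} [AddCommGroup P] {n : ℕ} (f : tpow M n →+ M →+ P)
    (hf : ∀ x (r : R) c, f (op r • x) c = f x (r • c)) : tpow M (n + 1) →+ P :=
  Bimod.lift f hf

@[simp] theorem snocLift_snoc {P : Type*} [AddCommGroup P] {n : ℕ} (f : tpow M n →+ M →+ P)
    (hf : ∀ x (r : R) c, f (op r • x) c = f x (r • c)) (x : tpow M n) (c : M) :
    snocLift f hf (snoc M n x c) = f x c := rfl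

@[elab_as_elim]
theorem tpow_cases {n : ℕ} {p : tpow M (n + 1) → Prop} (z : tpow M (n + 1))
    (snoc : ∀ x c, p (snoc M n x c)) (add : ∀ x y, p x → p y → p (x + y)) : p z :=
  Bimod.tensor_induction z snoc add

/-- The map `(x, y ⊗ c) ↦ f (x, y) ⊗ c`. -/
def snocStep {P : Type*} [AddCommGroup P] {n k : ℕ} (f : P →+ tpow M n →+ tpow M k)
    (hf : ∀ x (r : R) y, f x (op r • y) = op r • f x y) : P →+ tpow M (n + 1) →+ tpow M (k + 1) :=
  AddMonoidHom.mk' (fun x => snocLift ((snoc M k).comp (f x))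
    (fun y r c => by simp only [AddMonoidHom.comp_apply, hf]; exact snoc_smul _ _ _))
    (fun x y => Bimod.tensor_ext fun z c => by
      change snoc M k (f (x + y) z) c = snoc M k (f x z) c + snoc M k (f y z) c
      simp only [map_add, AddMonoidHom.add_apply])

theorem snocStep_right {P : Type*} [AddCommGroup P] {n k : ℕ} (f : P →+ tpow M n →+ tpow M k)
    (hf : ∀ x (r : R) y, f x (op r • y) = op r • f x y) (x : P) (r : R) (y : tpow M (n + 1)) :
    snocStep f hf x (op r • y) = op r • snocStep f hf x y := by
  induction y using tpow_cases with
  | snoc y c => rfl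
  | add y z hy hz => rw [smul_add, map_add, map_add, hy, hz, smul_add]

/-- Multiplication of the tensor ring, with its right linearity. -/
def tensMulAux (m : ℕ) : ∀ n, {f : tpow M m →+ tpow M n →+ tpow M (m + n) //
    ∀ x (r : R) y, f x (op r • y) = op r • f x y}
  | 0 => ⟨Bimod.rmul (tpow M m), fun x r y => (Bimod.op_op_smul x (show R from y) r).symm⟩
  | n + 1 => ⟨snocStep (tensMulAux m n).1 (tensMulAux m n).2,
      snocStep_right (tensMulAux m n).1 (tensMulAux m n).2⟩

/-- Multiplication of the tensor ring: concatenation of tensors. -/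
def tensMul (m n : ℕ) : tpow M m →+ tpow M n →+ tpow M (m + n) := (tensMulAux m n).1

theorem tensMul_right {m n : ℕ} (x : tpow M m) (r : R) (y : tpow M n) :
    tensMul m n x (op r • y) = op r • tensMul m n x y := (tensMulAux m n).2 x r y

@[simp] theorem tensMul_unitR {m : ℕ} (x : tpow M m) (r : R) :
    tensMul m 0 x (unitR M r) = op r • x := rfl

@[simp] theorem tensMul_snoc {m n : ℕ} (x : tpow M m) (y : tpow M n) (c : M) :
    tensMul m (n + 1) x (snoc M n y c) = snoc M (m + n) (tensMul m n x y) c := rfl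

theorem gcast_snoc {m n : ℕ} (h : m = n) (x : tpow M m) (c : M) :
    gcast (A := fun n => tpow M n) (congrArg (· + 1) h) (snoc M m x c) =
      snoc M n (gcast (A := fun n => tpow M n) h x) c := by
  subst h; rfl

theorem unitR_tensMul (n : ℕ) (x : tpow M n) :
    gcast (A := fun n => tpow M n) (Nat.zero_add n) (tensMul 0 n (unitR M 1) x) = x := by
  induction n with
  | zero => exact one_mul (M := R) x
  | succ n ih =>
    induction x using tpow_cases with
    | snoc x c =>
      rw [tensMul_snoc]
      exact (gcast_snoc (Nat.zero_add n) _ c).trans (by rw [ih])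
    | add x y hx hy => rw [map_add, map_add, hx, hy]

theorem tensMul_assoc (l m n : ℕ) (x : tpow M l) (y : tpow M m) (z : tpow M n) :
    gcast (A := fun n => tpow M n) (Nat.add_assoc l m n) (tensMul _ _ (tensMul _ _ x y) z) =
      tensMul _ _ x (tensMul _ _ y z) := by
  induction n with
  | zero => exact (tensMul_right x (z : R) y).symm
  | succ n ih =>
    induction z using tpow_cases with
    | snoc z c =>
      rw [tensMul_snoc, tensMul_snoc]
      exact (gcast_snoc (Nat.add_assoc l m n) _ c).trans (by rw [ih]; rfl)
    | add z w hz hw => rw [map_add, map_add, hz, hw, map_add, map_add]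

/-- The tensor ring of a bimodule, as a graded ring. -/
@[reducible] def tensorRing (M : Bimod.{u, u, u} R R) : DirectSum.GRing (fun n => tpow M n) :=
  gringMk tensMul (unitR M 1) unitR_tensMul (fun _ x => one_smul Rᵐᵒᵖ x) tensMul_assoc

/-- The map of tensor powers induced by a bimodule homomorphism. -/
def tpowMap {M N : Bimod.{u, u, u} R R} (f : BimodHom M N) : ∀ n, BimodHom (tpow M n) (tpow N n)
  | 0 => ⟨AddMonoidHom.id R, fun _ _ => rfl, fun _ _ => rfl⟩
  | n + 1 => Bimod.mapHom (tpowMap f n) f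

@[simp] theorem tpowMap_unitR {M N : Bimod.{u, u, u} R R} (f : BimodHom M N) (r : R) :
    tpowMap f 0 (unitR M r) = unitR N r := rfl

@[simp] theorem tpowMap_snoc {M N : Bimod.{u, u, u} R R} (f : BimodHom M N) {n : ℕ}
    (x : tpow M n) (c : M) : tpowMap f (n + 1) (snoc M n x c) = snoc N n (tpowMap f n x) (f c) :=
  rfl

theorem tpowMap_mul {M N : Bimod.{u, u, u} R R} (f : BimodHom M N) (m n : ℕ)
    (x : tpow M m) (y : tpow M n) :
    tpowMap f (m + n) (tensMul m n x y) = tensMul m n (tpowMap f m x) (tpowMap f n y) := by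
  induction n with
  | zero => exact (tpowMap f m).right y x
  | succ n ih =>
    induction y using tpow_cases with
    | snoc y c => rw [tensMul_snoc, tpowMap_snoc, tensMul_snoc, ← ih]; rfl
    | add y z hy hz => simp only [map_add, hy, hz]

end TensorRing

/-! ### Corings and the Amitsur complex -/

/-- An `R`-coring: an `(R, R)`-bimodule `C` with bimodule maps `Δ : C → C ⊗_R C` and `ε : C → R`
which are coassociative and counital. -/
structure Coring (R : Type u) [Ring R] where
  C : Bimod.{u, u, u} R R
  Δ : BimodHom C (Bimod.tensor C C)
  ε : BimodHom C (Bimod.regular R)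
  coassoc : ∀ c, Bimod.assoc C C C (Bimod.mapHom Δ (Bimod.idHom C) (Δ c)) =
    Bimod.mapHom (Bimod.idHom C) Δ (Δ c)
  counit_left : ∀ c, Bimod.lid C (Bimod.mapHom ε (Bimod.idHom C) (Δ c)) = c
  counit_right : ∀ c, Bimod.rid C (Bimod.mapHom (Bimod.idHom C) ε (Δ c)) = c

namespace Coring

variable {R : Type u} [Ring R] (𝒞 : Coring R)

/-- The counit with values in `R`. -/
def counit : 𝒞.C →+ R := 𝒞.ε.toAddMonoidHom

theorem counit_smul (r : R) (c : 𝒞.C) : 𝒞.counit (r • c) = r * 𝒞.counit c := 𝒞.ε.left r c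

theorem counit_op_smul (r : R) (c : 𝒞.C) : 𝒞.counit (op r • c) = 𝒞.counit c * r := 𝒞.ε.right r c

/-- Grouplike elements: `Δ g = g ⊗ g` and `ε g = 1` (so that `g ≠ 0` unless `R` is trivial). -/
structure IsGrouplike (g : 𝒞.C) : Prop where
  comul : 𝒞.Δ g = Bimod.tmul 𝒞.C 𝒞.C g g
  counit : 𝒞.counit g = 1

/-- The kernel of the counit, as an `(R, R)`-bimodule. -/
def kerCounit : Bimod.{u, u, u} R R :=
  letI l : Module R 𝒞.counit.ker :=
    { smul := fun r c => ⟨r • c.1, by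
        have h : 𝒞.counit c.1 = 0 := c.2
        change 𝒞.counit (r • c.1) = 0
        rw [counit_smul, h, mul_zero]⟩
      one_smul := fun c => Subtype.ext (one_smul R c.1)
      mul_smul := fun r s c => Subtype.ext (mul_smul r s c.1)
      smul_zero := fun r => Subtype.ext (smul_zero r)
      smul_add := fun r c c' => Subtype.ext (smul_add r c.1 c'.1)
      add_smul := fun r s c => Subtype.ext (add_smul r s c.1)
      zero_smul := fun c => Subtype.ext (zero_smul R c.1) }
  letI r : Module Rᵐᵒᵖ 𝒞.counit.ker :=
    { smul := fun r c => ⟨r • c.1, by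
        have h : 𝒞.counit c.1 = 0 := c.2
        change 𝒞.counit (op r.unop • c.1) = 0
        rw [counit_op_smul, h, zero_mul]⟩
      one_smul := fun c => Subtype.ext (one_smul Rᵐᵒᵖ c.1)
      mul_smul := fun r s c => Subtype.ext (mul_smul r s c.1)
      smul_zero := fun r => Subtype.ext (smul_zero r)
      smul_add := fun r c c' => Subtype.ext (smul_add r c.1 c'.1)
      add_smul := fun r s c => Subtype.ext (add_smul r s c.1)
      zero_smul := fun c => Subtype.ext (zero_smul Rᵐᵒᵖ c.1) }
  { carrier := 𝒞.counit.ker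
    left := l
    right := r
    comm := ⟨fun r s c => Subtype.ext (smul_comm r s c.1)⟩ }

/-- The inclusion of the kernel of the counit. -/
def kerIncl : BimodHom 𝒞.kerCounit 𝒞.C := ⟨𝒞.counit.ker.subtype, fun _ _ => rfl, fun _ _ => rfl⟩

/-- An element of the kernel of the counit. -/
def kerMk (c : 𝒞.C) (h : 𝒞.counit c = 0) : 𝒞.kerCounit := (⟨c, h⟩ : 𝒞.counit.ker)

@[simp] theorem kerIncl_kerMk (c : 𝒞.C) (h : 𝒞.counit c = 0) : 𝒞.kerIncl (𝒞.kerMk c h) = c := rfl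

theorem counit_kerIncl (k : 𝒞.kerCounit) : 𝒞.counit (𝒞.kerIncl k) = 0 :=
  (show 𝒞.counit.ker from k).2

theorem kerIncl_injective : Function.Injective 𝒞.kerIncl := fun _ _ h => Subtype.ext h

/-- `cons c x` is `c ⊗ x`, that is `1 ⊗ c ⊗ x` for `x` of positive degree and
`1 ⊗ c r` for `x = r ∈ R`. -/
def cons (c : 𝒞.C) : ∀ n, {f : tpow 𝒞.C n →+ tpow 𝒞.C (n + 1) //
    ∀ (r : R) x, f (op r • x) = op r • f x}
  | 0 => ⟨(snoc 𝒞.C 0 (unitR 𝒞.C 1)).comp (Bimod.rmul 𝒞.C c), fun r x => by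
      change snoc 𝒞.C 0 (unitR 𝒞.C 1) (op ((show R from x) * r) • c) = _
      rw [MulOpposite.op_mul, mul_smul]; rfl⟩
  | n + 1 => ⟨snocLift ((snoc 𝒞.C (n + 1)).comp (cons c n).1) (fun x r k => by
        simp only [AddMonoidHom.comp_apply, (cons c n).2]
        exact snoc_smul _ _ _), fun r x => by
        induction x using tpow_cases with
        | snoc x k => rfl
        | add x y hx hy => rw [smul_add, map_add, map_add, hx, hy, smul_add]⟩

/-- `snoc₂ x (c ⊗ c')` is `x ⊗ c ⊗ c'`. -/
def snoc₂ {M : Bimod.{u, u, u} R R} {n : ℕ} (x : tpow M n) :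
    Bimod.tensor M M →+ tpow M (n + 2) :=
  Bimod.lift ((snoc M (n + 1)).comp (snoc M n x)) (fun c r c' => by
    simp only [AddMonoidHom.comp_apply, ← right_snoc]
    exact snoc_smul _ _ _)

@[simp] theorem snoc₂_tmul {M : Bimod.{u, u, u} R R} {n : ℕ} (x : tpow M n) (c c' : M) :
    snoc₂ x (Bimod.tmul M M c c') = snoc M (n + 1) (snoc M n x c) c' := rfl

theorem snoc₂_right {M : Bimod.{u, u, u} R R} {n : ℕ} (x : tpow M n) (r : R)
    (z : Bimod.tensor M M) : snoc₂ x (op r • z) = op r • snoc₂ x z := by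
  induction z using Bimod.tensor_induction with
  | tmul c c' => rfl
  | add z w hz hw => rw [smul_add, map_add, map_add, hz, hw, smul_add]

theorem snoc₂_smul {M : Bimod.{u, u, u} R R} {n : ℕ} (x : tpow M n) (r : R)
    (z : Bimod.tensor M M) : snoc₂ (op r • x) z = snoc₂ x (r • z) := by
  induction z using Bimod.tensor_induction with
  | tmul c c' =>
    rw [snoc₂_tmul, snoc_smul]; rfl
  | add z w hz hw => rw [smul_add, map_add, map_add, hz, hw]

theorem snoc₂_add {M : Bimod.{u, u, u} R R} {n : ℕ} (x y : tpow M n)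
    (z : Bimod.tensor M M) : snoc₂ (x + y) z = snoc₂ x z + snoc₂ y z := by
  induction z using Bimod.tensor_induction with
  | tmul c c' => simp only [snoc₂_tmul, map_add, AddMonoidHom.add_apply]
  | add z w hz hw => rw [map_add, map_add, map_add, hz, hw]; abel

/-- The map `(x, c) ↦ x ⊗ Δ c`. -/
def snocΔ (n : ℕ) : tpow 𝒞.C n →+ 𝒞.C →+ tpow 𝒞.C (n + 2) :=
  AddMonoidHom.mk' (fun x => (snoc₂ x).comp 𝒞.Δ.toAddMonoidHom)
    (fun x y => by ext c; exact snoc₂_add x y (𝒞.Δ c))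

theorem snocΔ_apply {n : ℕ} (x : tpow 𝒞.C n) (c : 𝒞.C) : 𝒞.snocΔ n x c = snoc₂ x (𝒞.Δ c) := rfl

theorem snocΔ_smul {n : ℕ} (x : tpow 𝒞.C n) (r : R) (c : 𝒞.C) :
    𝒞.snocΔ n (op r • x) c = 𝒞.snocΔ n x (r • c) := by
  rw [snocΔ_apply, snocΔ_apply, snoc₂_smul, 𝒞.Δ.left]

theorem snocΔ_right {n : ℕ} (x : tpow 𝒞.C n) (r : R) (c : 𝒞.C) :
    𝒞.snocΔ n x (op r • c) = op r • 𝒞.snocΔ n x c := by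
  rw [snocΔ_apply, snocΔ_apply, 𝒞.Δ.right, snoc₂_right]

/-- The alternating sum `∑ᵢ (-1)ⁱ c¹ ⊗ ⋯ ⊗ Δ cⁱ ⊗ ⋯ ⊗ cⁿ` over `1 ≤ i ≤ n`. -/
def innerSum : ∀ n, {f : tpow 𝒞.C n →+ tpow 𝒞.C (n + 1) // ∀ (r : R) x, f (op r • x) = op r • f x}
  | 0 => ⟨0, fun r x => (smul_zero _).symm⟩
  | n + 1 => ⟨snocLift ((snoc 𝒞.C (n + 1)).comp (innerSum n).1 + (-1 : ℤ) ^ (n + 1) • 𝒞.snocΔ n)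
      (fun x r c => by
        simp only [AddMonoidHom.add_apply, AddMonoidHom.comp_apply, (innerSum n).2,
          AddMonoidHom.zsmul_apply, snocΔ_smul]
        rw [snoc_smul]), fun r x => by
        induction x using tpow_cases with
        | snoc x k =>
          rw [right_snoc, snocLift_snoc, snocLift_snoc]
          simp only [AddMonoidHom.add_apply, AddMonoidHom.comp_apply,
            AddMonoidHom.zsmul_apply, snocΔ_right, smul_add]
          rw [smul_comm]; rfl
        | add x y hx hy => rw [smul_add, map_add, map_add, hx, hy, smul_add]⟩

/-- The Amitsur differential
`d (c¹ ⊗ ⋯ ⊗ cⁿ) = g ⊗ c¹ ⊗ ⋯ ⊗ cⁿ + ∑ᵢ (-1)ⁱ c¹ ⊗ ⋯ ⊗ Δ cⁱ ⊗ ⋯ ⊗ cⁿ + (-1)ⁿ⁺¹ c¹ ⊗ ⋯ ⊗ cⁿ ⊗ g`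
on the tensor ring of the coring; in degree zero it is `d r = g r - r g`. -/
def amitsur (g : 𝒞.C) (n : ℕ) : tpow 𝒞.C n →+ tpow 𝒞.C (n + 1) :=
  (𝒞.cons g n).1 + (𝒞.innerSum n).1 + (-1 : ℤ) ^ (n + 1) • (snoc 𝒞.C n).flip g

theorem amitsur_apply (g : 𝒞.C) {n : ℕ} (x : tpow 𝒞.C n) :
    𝒞.amitsur g n x =
      (𝒞.cons g n).1 x + (𝒞.innerSum n).1 x + (-1 : ℤ) ^ (n + 1) • snoc 𝒞.C n x g := rfl

theorem amitsur_unitR (g : 𝒞.C) (r : R) :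
    𝒞.amitsur g 0 (unitR 𝒞.C r) = snoc 𝒞.C 0 (unitR 𝒞.C 1) (op r • g - r • g) := by
  have h : snoc 𝒞.C 0 (unitR 𝒞.C r) g = snoc 𝒞.C 0 (unitR 𝒞.C 1) (r • g) := by
    rw [← snoc_smul, right_unitR, one_mul]
  simp only [amitsur, AddMonoidHom.add_apply, AddMonoidHom.zsmul_apply, AddMonoidHom.flip_apply, h]
  change snoc 𝒞.C 0 (unitR 𝒞.C 1) (op r • g) + 0 + _ = _
  simp [sub_eq_add_neg]

/-- `g ⊗ c - Δ c + c ⊗ g`, the differential of an element of degree one. -/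
def delta (g : 𝒞.C) : 𝒞.C →+ Bimod.tensor 𝒞.C 𝒞.C :=
  Bimod.tmul 𝒞.C 𝒞.C g - 𝒞.Δ.toAddMonoidHom + (Bimod.tmul 𝒞.C 𝒞.C).flip g

theorem delta_apply (g c : 𝒞.C) : 𝒞.delta g c =
    Bimod.tmul 𝒞.C 𝒞.C g c - 𝒞.Δ c + Bimod.tmul 𝒞.C 𝒞.C c g := rfl

theorem amitsur_snoc (g : 𝒞.C) {n : ℕ} (x : tpow 𝒞.C n) (c : 𝒞.C) :
    𝒞.amitsur g (n + 1) (snoc 𝒞.C n x c) =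
      snoc 𝒞.C (n + 1) (𝒞.amitsur g n x) c + (-1 : ℤ) ^ n • snoc₂ x (𝒞.delta g c) := by
  have h1 : (𝒞.cons g (n + 1)).1 (snoc 𝒞.C n x c) = snoc 𝒞.C (n + 1) ((𝒞.cons g n).1 x) c := rfl
  have h2 : (𝒞.innerSum (n + 1)).1 (snoc 𝒞.C n x c) =
    snoc 𝒞.C (n + 1) ((𝒞.innerSum n).1 x) c + (-1 : ℤ) ^ (n + 1) • snoc₂ x (𝒞.Δ c) := rfl
  simp only [amitsur, AddMonoidHom.add_apply, AddMonoidHom.zsmul_apply, AddMonoidHom.flip_apply,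
    h1, h2, map_add, delta_apply, map_sub, snoc₂_tmul, map_zsmul, smul_add, smul_sub, pow_succ,
    mul_neg, mul_one, neg_smul, neg_neg, map_neg, AddMonoidHom.neg_apply]
  abel

theorem amitsur_right (g : 𝒞.C) {n : ℕ} (x : tpow 𝒞.C n) (r : R) :
    𝒞.amitsur g n (op r • x) =
      op r • 𝒞.amitsur g n x + (-1 : ℤ) ^ n • snoc 𝒞.C n x (op r • g - r • g) := by
  have h : op r • snoc 𝒞.C n x g = snoc 𝒞.C n x (op r • g) := rfl
  rw [amitsur_apply, amitsur_apply, (𝒞.cons g n).2, (𝒞.innerSum n).2, snoc_smul, smul_add,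
    smul_add, smul_comm (op r), h, map_sub]
  simp only [smul_sub, pow_succ, mul_neg, mul_one, neg_smul]
  abel

theorem tensMul_snoc₂ {M : Bimod.{u, u, u} R R} {m n : ℕ} (x : tpow M m) (y : tpow M n)
    (z : Bimod.tensor M M) :
    tensMul m (n + 2) x (snoc₂ y z) = snoc₂ (tensMul m n x y) z := by
  induction z using Bimod.tensor_induction with
  | tmul c c' => rfl
  | add z w hz hw =>
    rw [map_add, map_add, map_add, hz, hw]

theorem amitsur_mul (g : 𝒞.C) (m n : ℕ) (x : tpow 𝒞.C m) (y : tpow 𝒞.C n) :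
    𝒞.amitsur g (m + n) (tensMul m n x y) =
      gcast (A := fun n => tpow 𝒞.C n) (Nat.succ_add m n)
        (tensMul (m + 1) n (𝒞.amitsur g m x) y) +
      (-1 : ℤ) ^ m • tensMul m (n + 1) x (𝒞.amitsur g n y) := by
  induction n with
  | zero =>
    have h : 𝒞.amitsur g 0 y = snoc 𝒞.C 0 (unitR 𝒞.C 1) (op (show R from y) • g - (show R from y) • g) :=
      𝒞.amitsur_unitR g y
    rw [h]
    refine (𝒞.amitsur_right g x y).trans ?_
    rw [tensMul_snoc, tensMul_unitR, MulOpposite.op_one, one_smul]; rfl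
  | succ n ih =>
    induction y using tpow_cases with
    | snoc y c =>
      rw [tensMul_snoc, tensMul_snoc, amitsur_snoc, map_add, map_zsmul, tensMul_snoc₂]
      refine (𝒞.amitsur_snoc g (tensMul m n x y) c).trans ?_
      rw [ih, map_add, AddMonoidHom.add_apply, map_zsmul, AddMonoidHom.zsmul_apply, smul_add,
        smul_smul, ← pow_add]
      refine (add_assoc _ _ _).trans ?_
      exact congrArg₂ (· + ·) (gcast_snoc (Nat.succ_add m n) _ c).symm rfl
    | add y z hy hz =>
      simp only [map_add, smul_add]
      refine (congrArg₂ (· + ·) hy hz).trans ?_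
      exact add_add_add_comm _ _ _ _

end Coring

namespace Coring

variable {R : Type u} [Ring R] (𝒞 : Coring R)

/-! #### The Amitsur differential squares to zero -/

section Square

variable {M : Bimod.{u, u, u} R R} {n : ℕ}

/-- The map `(c ⊗ c') ⊗ c'' ↦ x ⊗ c ⊗ c' ⊗ c''`. -/
def snoc₃L (x : tpow M n) : Bimod.tensor (Bimod.tensor M M) M →+ tpow M (n + 3) :=
  Bimod.lift ((snoc M (n + 2)).comp (snoc₂ x)) (fun t r c => by
    rw [AddMonoidHom.comp_apply, AddMonoidHom.comp_apply, snoc₂_right, snoc_smul])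

/-- The map `c ⊗ (c' ⊗ c'') ↦ x ⊗ c ⊗ c' ⊗ c''`. -/
def snoc₃R (x : tpow M n) : Bimod.tensor M (Bimod.tensor M M) →+ tpow M (n + 3) :=
  Bimod.lift (AddMonoidHom.mk' (fun c => snoc₂ (snoc M n x c))
    (fun c c' => by ext t; rw [map_add, snoc₂_add]; rfl))
    (fun c r t => by
      change snoc₂ (snoc M n x (op r • c)) t = snoc₂ (snoc M n x c) (r • t)
      rw [← right_snoc, snoc₂_smul])

theorem snoc₃L_tmul (x : tpow M n) (t : Bimod.tensor M M) (c : M) :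
    snoc₃L x (Bimod.tmul (Bimod.tensor M M) M t c) = snoc M (n + 2) (snoc₂ x t) c := rfl

theorem snoc₃R_tmul (x : tpow M n) (c : M) (t : Bimod.tensor M M) :
    snoc₃R x (Bimod.tmul M (Bimod.tensor M M) c t) = snoc₂ (snoc M n x c) t := rfl

theorem snoc₃R_assoc (x : tpow M n) (z : Bimod.tensor (Bimod.tensor M M) M) :
    snoc₃R x (Bimod.assoc M M M z) = snoc₃L x z := by
  induction z using Bimod.tensor_induction with
  | tmul t c =>
    induction t using Bimod.tensor_induction with
    | tmul a b => rfl
    | add s t hs ht => simp only [map_add, AddMonoidHom.add_apply, hs, ht]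
  | add z w hz hw => rw [map_add, map_add, map_add, hz, hw]

end Square

theorem amitsur_snoc₂ (g : 𝒞.C) {n : ℕ} (x : tpow 𝒞.C n) (z : Bimod.tensor 𝒞.C 𝒞.C) :
    𝒞.amitsur g (n + 2) (snoc₂ x z) = snoc₂ (𝒞.amitsur g n x) z +
      (-1 : ℤ) ^ n • (snoc₂ (snoc 𝒞.C n x g) z -
        snoc₃L x (Bimod.mapHom 𝒞.Δ (Bimod.idHom 𝒞.C) z) +
        snoc₃R x (Bimod.mapHom (Bimod.idHom 𝒞.C) 𝒞.Δ z) -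
        snoc 𝒞.C (n + 2) (snoc₂ x z) g) := by
  induction z using Bimod.tensor_induction with
  | tmul c c' =>
    simp only [Bimod.mapHom_tmul, snoc₃L_tmul, snoc₃R_tmul, Bimod.idHom_apply, snoc₂_tmul,
      amitsur_snoc, delta_apply, map_add, map_sub, map_zsmul, AddMonoidHom.add_apply,
      AddMonoidHom.sub_apply, AddMonoidHom.zsmul_apply, smul_add, smul_sub, pow_succ, mul_neg,
      mul_one, neg_smul]
    abel
  | add z w hz hw =>
    simp only [map_add, hz, hw, smul_add, smul_sub, AddMonoidHom.add_apply]
    abel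

theorem amitsur_amitsur {g : 𝒞.C} (hg : 𝒞.IsGrouplike g) (n : ℕ) (x : tpow 𝒞.C n) :
    𝒞.amitsur g (n + 1) (𝒞.amitsur g n x) = 0 := by
  induction n with
  | zero =>
    change 𝒞.amitsur g 1 (𝒞.amitsur g 0 (unitR 𝒞.C (show R from x))) = 0
    generalize (show R from x) = r
    have h1 : 𝒞.amitsur g 0 (unitR 𝒞.C 1) = 0 := by
      rw [amitsur_unitR, MulOpposite.op_one, one_smul, one_smul, sub_self, map_zero]
    have h2 : 𝒞.delta g (op r • g - r • g) = 0 := by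
      have e : Bimod.tmul 𝒞.C 𝒞.C (op r • g) g = Bimod.tmul 𝒞.C 𝒞.C g (r • g) :=
        Bimod.tmul_smul g r g
      rw [delta_apply]
      simp only [map_sub, AddMonoidHom.sub_apply, 𝒞.Δ.left, 𝒞.Δ.right, hg.comul,
        Bimod.left_tmul, Bimod.right_tmul, e]
      abel
    rw [amitsur_unitR, amitsur_snoc, h1, h2]
    simp
  | succ n ih =>
    induction x using tpow_cases with
    | snoc x c =>
      have key : snoc₃L x (Bimod.mapHom 𝒞.Δ (Bimod.idHom 𝒞.C) (𝒞.Δ c)) =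
          snoc₃R x (Bimod.mapHom (Bimod.idHom 𝒞.C) 𝒞.Δ (𝒞.Δ c)) := by
        rw [← snoc₃R_assoc, 𝒞.coassoc]
      rw [amitsur_snoc, map_add, amitsur_snoc, ih, map_zsmul, amitsur_snoc₂]
      simp only [delta_apply, map_add, map_sub, Bimod.mapHom_tmul, snoc₃L_tmul, snoc₃R_tmul,
        Bimod.idHom_apply, hg.comul, snoc₂_tmul, key, AddMonoidHom.add_apply, map_zero,
        AddMonoidHom.sub_apply, AddMonoidHom.zero_apply, smul_add, smul_sub, pow_succ, mul_neg,
        mul_one, neg_smul]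
      abel
    | add x y hx hy => rw [map_add, map_add, hx, hy, add_zero]

/-! #### The forms with values in a coring -/

variable {𝒞}

/-- The right linear projection `c ↦ c - g ε(c)` onto the kernel of the counit. -/
def projR {g : 𝒞.C} (hg : 𝒞.IsGrouplike g) : 𝒞.C →+ 𝒞.kerCounit :=
  AddMonoidHom.mk' (fun c => 𝒞.kerMk (c - op (𝒞.counit c) • g) (by
      rw [map_sub, counit_op_smul, hg.counit, one_mul, sub_self]))
    (fun c c' => 𝒞.kerIncl_injective (by
      simp only [kerIncl_kerMk, map_add, MulOpposite.op_add, add_smul]; abel))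

/-- The left linear projection `c ↦ c - ε(c) g` onto the kernel of the counit. -/
def projL {g : 𝒞.C} (hg : 𝒞.IsGrouplike g) : 𝒞.C →+ 𝒞.kerCounit :=
  AddMonoidHom.mk' (fun c => 𝒞.kerMk (c - 𝒞.counit c • g) (by
      rw [map_sub, counit_smul, hg.counit, mul_one, sub_self]))
    (fun c c' => 𝒞.kerIncl_injective (by
      simp only [kerIncl_kerMk, map_add, add_smul]; abel))

section

variable {g : 𝒞.C} (hg : 𝒞.IsGrouplike g)

theorem kerIncl_projR (c : 𝒞.C) : 𝒞.kerIncl (projR hg c) = c - op (𝒞.counit c) • g := rfl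

theorem kerIncl_projL (c : 𝒞.C) : 𝒞.kerIncl (projL hg c) = c - 𝒞.counit c • g := rfl

theorem projR_right (r : R) (c : 𝒞.C) : projR hg (op r • c) = op r • projR hg c := by
  apply 𝒞.kerIncl_injective
  rw [BimodHom.right, kerIncl_projR, kerIncl_projR, counit_op_smul, MulOpposite.op_mul, mul_smul,
    smul_sub]

theorem projL_left (r : R) (c : 𝒞.C) : projL hg (r • c) = r • projL hg c := by
  apply 𝒞.kerIncl_injective
  rw [BimodHom.left, kerIncl_projL, kerIncl_projL, counit_smul, mul_smul, smul_sub]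

theorem projL_kerIncl (k : 𝒞.kerCounit) : projL hg (𝒞.kerIncl k) = k := by
  apply 𝒞.kerIncl_injective
  rw [kerIncl_projL, counit_kerIncl, zero_smul, sub_zero]

/-- The element `g r - r g` of the kernel of the counit. -/
def dZero (r : R) : 𝒞.kerCounit := 𝒞.kerMk (op r • g - r • g) (by
  rw [map_sub, counit_op_smul, counit_smul, hg.counit, mul_one, one_mul, sub_self])

theorem projL_right (r : R) (c : 𝒞.C) :
    projL hg (op r • c) = op r • projL hg c + 𝒞.counit c • dZero hg r := by
  apply 𝒞.kerIncl_injective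
  rw [map_add, BimodHom.right, BimodHom.left, kerIncl_projL, kerIncl_projL, counit_op_smul,
    dZero, kerIncl_kerMk, smul_sub, smul_sub, mul_smul, ← smul_comm (𝒞.counit c) (op r)]
  abel

/-- The map `c ⊗ c' ↦ (c - g ε(c)) ⊗ (c' - ε(c') g)`. -/
def proj₂ : Bimod.tensor 𝒞.C 𝒞.C →+ Bimod.tensor 𝒞.kerCounit 𝒞.kerCounit :=
  Bimod.map (projR hg) (projR_right hg) (projL hg) (projL_left hg)

theorem proj₂_tmul (c c' : 𝒞.C) : proj₂ hg (Bimod.tmul 𝒞.C 𝒞.C c c') =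
    Bimod.tmul _ _ (projR hg c) (projL hg c') := rfl

theorem incl_proj₂ (z : Bimod.tensor 𝒞.C 𝒞.C) :
    Bimod.mapHom 𝒞.kerIncl 𝒞.kerIncl (proj₂ hg z) = z -
      Bimod.tmul 𝒞.C 𝒞.C g (Bimod.lid 𝒞.C (Bimod.mapHom 𝒞.ε (Bimod.idHom 𝒞.C) z)) -
      Bimod.tmul 𝒞.C 𝒞.C (Bimod.rid 𝒞.C (Bimod.mapHom (Bimod.idHom 𝒞.C) 𝒞.ε z)) g +
      Bimod.tmul 𝒞.C 𝒞.C
        (op (𝒞.counit (Bimod.rid 𝒞.C (Bimod.mapHom (Bimod.idHom 𝒞.C) 𝒞.ε z))) • g) g := by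
  induction z using Bimod.tensor_induction with
  | tmul c c' =>
    have h1 : Bimod.lid 𝒞.C (Bimod.mapHom 𝒞.ε (Bimod.idHom 𝒞.C) (Bimod.tmul 𝒞.C 𝒞.C c c')) =
      𝒞.counit c • c' := rfl
    have h2 : Bimod.rid 𝒞.C (Bimod.mapHom (Bimod.idHom 𝒞.C) 𝒞.ε (Bimod.tmul 𝒞.C 𝒞.C c c')) =
      op (𝒞.counit c') • c := rfl
    rw [h1, h2, proj₂_tmul, Bimod.mapHom_tmul, kerIncl_projR, kerIncl_projL, counit_op_smul]
    simp only [map_sub, AddMonoidHom.sub_apply, ← Bimod.tmul_smul, MulOpposite.op_mul, mul_smul]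
    abel
  | add z w hz hw =>
    simp only [map_add, hz, hw, MulOpposite.op_add, add_smul, AddMonoidHom.add_apply]
    abel

theorem incl_proj₂_Δ (k : 𝒞.kerCounit) :
    Bimod.mapHom 𝒞.kerIncl 𝒞.kerIncl (proj₂ hg (𝒞.Δ (𝒞.kerIncl k))) =
      -𝒞.delta g (𝒞.kerIncl k) := by
  rw [incl_proj₂, 𝒞.counit_left, 𝒞.counit_right, counit_kerIncl, MulOpposite.op_zero, zero_smul,
    map_zero, AddMonoidHom.zero_apply, delta_apply]
  abel

theorem tpowMap_snoc₂ {M N : Bimod.{u, u, u} R R} (f : BimodHom M N) {n : ℕ} (x : tpow M n)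
    (z : Bimod.tensor M M) :
    tpowMap f (n + 2) (snoc₂ x z) = snoc₂ (tpowMap f n x) (Bimod.mapHom f f z) := by
  induction z using Bimod.tensor_induction with
  | tmul c c' => rfl
  | add z w hz hw => rw [map_add, map_add, map_add, map_add, hz, hw]

/-- The canonical map from the tensor powers of the kernel of the counit to those of `C`. -/
def incl (𝒞 : Coring R) (n : ℕ) : BimodHom (tpow 𝒞.kerCounit n) (tpow 𝒞.C n) := tpowMap 𝒞.kerIncl n

theorem amitsur_incl_mem {g : 𝒞.C} (hg : 𝒞.IsGrouplike g) (n : ℕ) (x : tpow 𝒞.kerCounit n) :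
    ∃ y, 𝒞.incl (n + 1) y = 𝒞.amitsur g n (𝒞.incl n x) := by
  induction n with
  | zero => exact ⟨snoc _ 0 (unitR _ 1) (dZero hg x), (𝒞.amitsur_unitR g x).symm⟩
  | succ n ih =>
    induction x using tpow_cases with
    | snoc x k =>
      obtain ⟨y, hy⟩ := ih x
      refine ⟨snoc _ (n + 1) y k - (-1 : ℤ) ^ n • snoc₂ x (proj₂ hg (𝒞.Δ (𝒞.kerIncl k))), ?_⟩
      have e : 𝒞.incl (n + 1) (snoc _ n x k) = snoc 𝒞.C n (𝒞.incl n x) (𝒞.kerIncl k) := rfl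
      rw [e, amitsur_snoc, ← hy, map_sub, map_zsmul]
      unfold incl
      rw [tpowMap_snoc, tpowMap_snoc₂, incl_proj₂_Δ, map_neg, smul_neg, sub_neg_eq_add]
    | add x y hx hy =>
      obtain ⟨x', hx⟩ := hx
      obtain ⟨y', hy⟩ := hy
      exact ⟨x' + y', by rw [map_add, map_add, map_add, hx, hy]⟩

end

/-- The map `c¹ ⊗ ⋯ ⊗ cⁿ ⊗ c ↦ c¹ ⊗ ⋯ ⊗ cⁿ ε(c)`. -/
def lastCounit (𝒞 : Coring R) (n : ℕ) : tpow 𝒞.C (n + 1) →+ tpow 𝒞.C n :=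
  snocLift ((AddMonoidHom.compHom.flip 𝒞.counit).comp (Bimod.rmul (tpow 𝒞.C n))) (fun x r c => by
    change op (𝒞.counit c) • op r • x = op (𝒞.counit (r • c)) • x
    rw [counit_smul, Bimod.op_op_smul])

theorem lastCounit_snoc {n : ℕ} (x : tpow 𝒞.C n) (c : 𝒞.C) :
    𝒞.lastCounit n (snoc 𝒞.C n x c) = op (𝒞.counit c) • x := rfl

end Coring

namespace Coring

variable {R : Type u} [Ring R] {𝒞 : Coring R}

/-- The right linear map `r ↦ g r`, `c¹ ⊗ ⋯ ⊗ cⁿ ↦ c¹ ⊗ ⋯ ⊗ Δ cⁿ`, a section of `lastCounit`. -/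
def coact {g : 𝒞.C} (hg : 𝒞.IsGrouplike g) : ∀ n, {f : tpow 𝒞.C n →+ tpow 𝒞.C (n + 1) //
    (∀ (r : R) x, f (op r • x) = op r • f x) ∧ ∀ x, 𝒞.lastCounit n (f x) = x}
  | 0 => ⟨(snoc 𝒞.C 0 (unitR 𝒞.C 1)).comp (Bimod.rmul 𝒞.C g),
      fun r x => congrArg (snoc 𝒞.C 0 (unitR 𝒞.C 1)) (Bimod.op_op_smul g (show R from x) r).symm,
      fun x => by
        change op (𝒞.counit (op (show R from x) • g)) • unitR 𝒞.C 1 = unitR 𝒞.C (show R from x)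
        rw [counit_op_smul, hg.counit, right_unitR, one_mul, one_mul]⟩
  | n + 1 => ⟨snocLift (𝒞.snocΔ n) (fun x r c => 𝒞.snocΔ_smul x r c), fun r x => by
        induction x using tpow_cases with
        | snoc x c => exact 𝒞.snocΔ_right x r c
        | add x y hx hy => rw [smul_add, map_add, map_add, hx, hy, smul_add], fun x => by
        induction x using tpow_cases with
        | snoc x c =>
          have key : ∀ z, 𝒞.lastCounit (n + 1) (snoc₂ x z) =
              snoc 𝒞.C n x (Bimod.rid 𝒞.C (Bimod.mapHom (Bimod.idHom 𝒞.C) 𝒞.ε z)) := by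
            intro z
            induction z using Bimod.tensor_induction with
            | tmul c c' => rfl
            | add z w hz hw => simp only [map_add, hz, hw]
          rw [snocLift_snoc, snocΔ_apply, key, 𝒞.counit_right]
        | add x y hx hy => rw [map_add, map_add, hx, hy]⟩

theorem lastCounit_right {n : ℕ} (r : R) (x : tpow 𝒞.C (n + 1)) :
    𝒞.lastCounit n (op r • x) = op r • 𝒞.lastCounit n x := by
  induction x using tpow_cases with
  | snoc x c =>
    rw [right_snoc, lastCounit_snoc, lastCounit_snoc, counit_op_smul, Bimod.op_op_smul]
  | add x y hx hy => rw [smul_add, map_add, map_add, hx, hy, smul_add]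

/-- The canonical maps `incl` have right linear retractions. -/
theorem exists_retract {g : 𝒞.C} (hg : 𝒞.IsGrouplike g) (n : ℕ) :
    ∃ f : tpow 𝒞.C n →+ tpow 𝒞.kerCounit n,
      (∀ (r : R) x, f (op r • x) = op r • f x) ∧ ∀ x, f (𝒞.incl n x) = x := by
  induction n with
  | zero => exact ⟨AddMonoidHom.id R, fun _ _ => rfl, fun _ => rfl⟩
  | succ n ih =>
    obtain ⟨f, hf, hi⟩ := ih
    obtain ⟨N, hN⟩ : ∃ N : tpow 𝒞.C (n + 1) →+ tpow 𝒞.kerCounit (n + 1), ∀ x c,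
        N (snoc 𝒞.C n x c) = snoc 𝒞.kerCounit n (f x) (projL hg c) :=
      ⟨Bimod.map f hf (projL hg) (projL_left hg), fun _ _ => rfl⟩
    have hr : ∀ (r : R) z, N (op r • z) = op r • N z +
        snoc 𝒞.kerCounit n (f (𝒞.lastCounit n z)) (dZero hg r) := by
      intro r z
      induction z using tpow_cases with
      | snoc x c =>
        rw [right_snoc, hN, hN, projL_right, map_add, lastCounit_snoc, hf, snoc_smul, right_snoc]
      | add x y hx hy =>
        simp only [smul_add, map_add, hx, hy, AddMonoidHom.add_apply]; abel
    refine ⟨N.comp (AddMonoidHom.id (tpow 𝒞.C (n + 1)) -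
      (coact hg n).1.comp (𝒞.lastCounit n)), fun r x => ?_, fun x => ?_⟩
    · have h : 𝒞.lastCounit n (x - (coact hg n).1 (𝒞.lastCounit n x)) = 0 := by
        rw [map_sub, (coact hg n).2.2, sub_self]
      simp only [AddMonoidHom.comp_apply, AddMonoidHom.sub_apply, AddMonoidHom.id_apply]
      rw [lastCounit_right, (coact hg n).2.1, ← smul_sub, hr, h, map_zero, map_zero,
        AddMonoidHom.zero_apply, add_zero]
    · induction x using tpow_cases with
      | snoc x k =>
        have e : 𝒞.incl (n + 1) (snoc _ n x k) = snoc 𝒞.C n (𝒞.incl n x) (𝒞.kerIncl k) := rfl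
        simp only [AddMonoidHom.comp_apply, AddMonoidHom.sub_apply, AddMonoidHom.id_apply]
        rw [e, lastCounit_snoc, counit_kerIncl, MulOpposite.op_zero, zero_smul, map_zero,
          sub_zero, hN, hi, projL_kerIncl]
      | add x y hx hy => rw [map_add, map_add, hx, hy]

theorem incl_injective {g : 𝒞.C} (hg : 𝒞.IsGrouplike g) (n : ℕ) :
    Function.Injective (𝒞.incl n) :=
  let ⟨f, _, hf⟩ := exists_retract hg n
  Function.LeftInverse.injective (g := f) hf

/-- The restriction of the Amitsur differential to the tensor powers of the kernel of the
counit, characterised by `incl_formsD`. -/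
def formsD {g : 𝒞.C} (hg : 𝒞.IsGrouplike g) (n : ℕ) :
    tpow 𝒞.kerCounit n →+ tpow 𝒞.kerCounit (n + 1) :=
  AddMonoidHom.mk' (fun x => Classical.choose (amitsur_incl_mem hg n x)) (fun x y => by
    apply incl_injective hg
    refine (Classical.choose_spec (amitsur_incl_mem hg n (x + y))).trans ?_
    rw [map_add (𝒞.incl (n + 1)), map_add (𝒞.incl n), map_add]
    exact congrArg₂ (· + ·) (Classical.choose_spec (amitsur_incl_mem hg n x)).symm
      (Classical.choose_spec (amitsur_incl_mem hg n y)).symm)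

theorem incl_formsD {g : 𝒞.C} (hg : 𝒞.IsGrouplike g) (n : ℕ) (x : tpow 𝒞.kerCounit n) :
    𝒞.incl (n + 1) (formsD hg n x) = 𝒞.amitsur g n (𝒞.incl n x) :=
  Classical.choose_spec (amitsur_incl_mem hg n x)

theorem incl_mul (m n : ℕ) (x : tpow 𝒞.kerCounit m) (y : tpow 𝒞.kerCounit n) :
    𝒞.incl (m + n) (tensMul m n x y) = tensMul m n (𝒞.incl m x) (𝒞.incl n y) :=
  tpowMap_mul 𝒞.kerIncl m n x y

theorem incl_gcast {m n : ℕ} (h : m = n) (x : tpow 𝒞.kerCounit m) :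
    𝒞.incl n (gcast (A := fun n => tpow 𝒞.kerCounit n) h x) =
      gcast (A := fun n => tpow 𝒞.C n) h (𝒞.incl m x) := by
  subst h; rfl

theorem formsD_mul {g : 𝒞.C} (hg : 𝒞.IsGrouplike g) (m n : ℕ) (x : tpow 𝒞.kerCounit m)
    (y : tpow 𝒞.kerCounit n) :
    formsD hg (m + n) (tensMul m n x y) =
      gcast (A := fun n => tpow 𝒞.kerCounit n) (Nat.succ_add m n)
        (tensMul (m + 1) n (formsD hg m x) y) +
      (-1 : ℤ) ^ m • tensMul m (n + 1) x (formsD hg n y) := by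
  apply incl_injective hg
  rw [incl_formsD, incl_mul, amitsur_mul, map_add, map_zsmul, incl_gcast, incl_mul, incl_formsD]
  refine congrArg₂ (· + ·) rfl (congrArg _ ?_)
  exact ((incl_mul m (n + 1) x (formsD hg n y)).trans (by rw [incl_formsD])).symm

end Coring

/-- The Leibniz rule in `⨁ Ωⁿ` from the Leibniz rule for homogeneous elements. -/
theorem leibniz_of_gcast {A : ℕ → Type u} [∀ n, AddCommGroup (A n)] [DirectSum.GRing A] {m n : ℕ}
    {x : A m} {y : A n} {x' : A (m + 1)} {y' : A (n + 1)} {z : A (m + n + 1)}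
    (h : z = gcast (Nat.succ_add m n) (GradedMonoid.GMul.mul x' y) +
      (-1 : ℤ) ^ m • (GradedMonoid.GMul.mul x y' : A (m + (n + 1)))) :
    DirectSum.of A (m + n + 1) z =
      DirectSum.of A (m + 1) x' * DirectSum.of A n y +
        (-1) ^ m * (DirectSum.of A m x * DirectSum.of A (n + 1) y') := by
  rw [h, map_add, of_gcast, DirectSum.of_mul_of, DirectSum.of_mul_of, map_zsmul]
  rcases Nat.even_or_odd m with hm | hm <;> simp [hm.neg_one_pow] <;> rfl

/-- A ring homomorphism into the degree zero component of a graded ring. -/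
def degZeroHom {S : Type v} [Ring S] {A : ℕ → Type u} [∀ n, AddCommGroup (A n)]
    [DirectSum.GRing A] (f : S →+ A 0) (h1 : f 1 = (GradedMonoid.GOne.one : A 0))
    (hm : ∀ s t, f (s * t) = (GradedMonoid.GMul.mul (f s) (f t) : A (0 + 0))) : S →+* A 0 :=
  { f with
    map_one' := h1
    map_mul' := hm }

/-- The `S`-relative differential graded ring `Ω(C/S)` of differential forms with values in the
`R`-coring `C` with a grouplike element `g`: the tensor ring of the `(R, R)`-bimodule `ker ε`,
with the restriction of the Amitsur differential. Here `S → R` is a ring map whose image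
centralises `g`. -/
def Coring.forms {S : Type v} [Ring S] {R : Type u} [Ring R] (φ : S →+* R) (𝒞 : Coring R)
    (g : 𝒞.C) (hg : 𝒞.IsGrouplike g) (hφ : ∀ s, φ s • g = op (φ s) • g) : RelDGRing.{u, v} S :=
  letI := tensorRing 𝒞.kerCounit
  { Ω := fun n => tpow 𝒞.kerCounit n
    d := Coring.formsD hg
    d_d := fun n x => Coring.incl_injective hg _ (by
      rw [Coring.incl_formsD, Coring.incl_formsD, Coring.amitsur_amitsur 𝒞 hg, map_zero])
    leibniz := fun m n x y => leibniz_of_gcast (Coring.formsD_mul hg m n x y)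
    η := degZeroHom (A := fun n => tpow 𝒞.kerCounit n)
      ((unitR 𝒞.kerCounit).comp φ.toAddMonoidHom)
      (congrArg (unitR 𝒞.kerCounit) (map_one φ))
      (fun s t => congrArg (unitR 𝒞.kerCounit) (map_mul φ s t))
    d_η := fun s => Coring.incl_injective hg _ (by
      rw [Coring.incl_formsD]
      refine (𝒞.amitsur_unitR g (φ s)).trans ?_
      rw [hφ, sub_self, map_zero, map_zero]) }

/-! ### The canonical coring of a ring extension -/

section Extension

variable {S : Type v} {R : Type u} [Ring S] [Ring R] (φ : S →+* R)

/-- `R` as an `(R, S)`-bimodule along `S → R`. -/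
def resRight : Bimod.{u, v, u} R S :=
  letI r : Module Sᵐᵒᵖ R := Module.compHom R φ.op
  { carrier := R
    right := r
    comm := ⟨fun a s x => smul_comm a (φ.op s) x⟩ }

/-- `R` as an `(S, R)`-bimodule along `S → R`. -/
def resLeft : Bimod.{v, u, u} S R :=
  letI l : Module S R := Module.compHom R φ
  { carrier := R
    left := l
    comm := ⟨fun s a x => smul_comm (φ s) a x⟩ }

/-- The `(R, R)`-bimodule `R ⊗_S R`. -/
def sweedlerBimod : Bimod.{u, u, u} R R := Bimod.tensor (resRight φ) (resLeft φ)

/-- The element `r ⊗ r'` of `R ⊗_S R`. -/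
def rtmul : R →+ R →+ sweedlerBimod φ := Bimod.tmul (resRight φ) (resLeft φ)

variable {φ}

theorem rtmul_smul (r : R) (s : S) (r' : R) : rtmul φ (r * φ s) r' = rtmul φ r (φ s * r') :=
  Bimod.tmul_smul (X := resRight φ) (Y := resLeft φ) r s r'

theorem left_rtmul (a r r' : R) : a • rtmul φ r r' = rtmul φ (a * r) r' := rfl

theorem right_rtmul (a r r' : R) : op a • rtmul φ r r' = rtmul φ r (r' * a) := rfl

@[elab_as_elim]
theorem sweedler_induction {p : sweedlerBimod φ → Prop} (z : sweedlerBimod φ)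
    (tmul : ∀ r r', p (rtmul φ r r')) (add : ∀ x y, p x → p y → p (x + y)) : p z :=
  Bimod.tensor_induction z tmul add

/-- Maps out of `R ⊗_S R`. -/
def rlift {P : Type*} [AddCommGroup P] (f : R →+ R →+ P)
    (hf : ∀ r (s : S) r', f (r * φ s) r' = f r (φ s * r')) : sweedlerBimod φ →+ P :=
  Bimod.lift (X := resRight φ) (Y := resLeft φ) f hf

theorem rlift_rtmul {P : Type*} [AddCommGroup P] (f : R →+ R →+ P)
    (hf : ∀ r (s : S) r', f (r * φ s) r' = f r (φ s * r')) (r r' : R) :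
    rlift f hf (rtmul φ r r') = f r r' := rfl

variable (φ)

/-- `Δ (r ⊗ r') = (r ⊗ 1) ⊗ (1 ⊗ r')`. -/
def sweedlerΔ : BimodHom (sweedlerBimod φ) (Bimod.tensor (sweedlerBimod φ) (sweedlerBimod φ)) where
  toAddMonoidHom := rlift
    (((Bimod.tmul (sweedlerBimod φ) (sweedlerBimod φ)).compl₂ (rtmul φ 1)).comp
      ((rtmul φ).flip 1)) (fun r s r' => by
      change Bimod.tmul (sweedlerBimod φ) (sweedlerBimod φ) (rtmul φ (r * φ s) 1) (rtmul φ 1 r') =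
        Bimod.tmul (sweedlerBimod φ) (sweedlerBimod φ) (rtmul φ r 1) (rtmul φ 1 (φ s * r'))
      rw [rtmul_smul, ← rtmul_smul 1 s r', mul_one, one_mul,
        show rtmul φ r (φ s) = op (φ s) • rtmul φ r 1 by rw [right_rtmul, one_mul],
        Bimod.tmul_smul, left_rtmul, mul_one])
  map_left a z := by
    change rlift _ _ (a • z) = a • rlift _ _ z
    induction z using sweedler_induction with
    | tmul r r' => rfl
    | add x y hx hy => rw [smul_add, map_add, map_add, hx, hy, smul_add]
  map_right a z := by
    change rlift _ _ (op a • z) = op a • rlift _ _ z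
    induction z using sweedler_induction with
    | tmul r r' => rfl
    | add x y hx hy => rw [smul_add, map_add, map_add, hx, hy, smul_add]

theorem sweedlerΔ_rtmul (r r' : R) : sweedlerΔ φ (rtmul φ r r') =
    Bimod.tmul (sweedlerBimod φ) (sweedlerBimod φ) (rtmul φ r 1) (rtmul φ 1 r') := rfl

/-- `ε (r ⊗ r') = r r'`. -/
def sweedlerε : BimodHom (sweedlerBimod φ) (Bimod.regular R) where
  toAddMonoidHom := rlift (P := R) AddMonoidHom.mul (fun r s r' => mul_assoc r (φ s) r')
  map_left a z := by
    change rlift (P := R) _ _ (a • z) = a * rlift (P := R) _ _ z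
    induction z using sweedler_induction with
    | tmul r r' => exact mul_assoc a r r'
    | add x y hx hy => rw [smul_add, map_add, map_add, hx, hy, mul_add]
  map_right a z := by
    change rlift (P := R) _ _ (op a • z) = rlift (P := R) _ _ z * a
    induction z using sweedler_induction with
    | tmul r r' => exact (mul_assoc r r' a).symm
    | add x y hx hy => rw [smul_add, map_add, map_add, hx, hy, add_mul]

/-- The canonical Sweedler coring `R ⊗_S R` of a ring extension `S → R`. -/
def sweedler : Coring R where
  C := sweedlerBimod φ
  Δ := sweedlerΔ φ
  ε := sweedlerε φ
  coassoc c := by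
    induction c using sweedler_induction with
    | tmul r r' => rfl
    | add x y hx hy => rw [map_add, map_add, map_add, map_add, hx, hy]
  counit_left c := by
    induction c using sweedler_induction with
    | tmul r r' =>
      change (r * 1) • rtmul φ 1 r' = rtmul φ r r'
      rw [left_rtmul, mul_one, mul_one]
    | add x y hx hy => rw [map_add, map_add, map_add, hx, hy]
  counit_right c := by
    induction c using sweedler_induction with
    | tmul r r' =>
      change op (1 * r') • rtmul φ r 1 = rtmul φ r r'
      rw [right_rtmul, one_mul, one_mul]
    | add x y hx hy => rw [map_add, map_add, map_add, hx, hy]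

/-- The grouplike element `1 ⊗ 1` of the Sweedler coring. -/
def sweedlerOne : (sweedler φ).C := rtmul φ 1 1

theorem sweedlerOne_isGrouplike : (sweedler φ).IsGrouplike (sweedlerOne φ) where
  comul := rfl
  counit := mul_one (1 : R)

theorem sweedlerOne_central (s : S) : φ s • sweedlerOne φ = op (φ s) • sweedlerOne φ := by
  change φ s • rtmul φ 1 1 = op (φ s) • rtmul φ 1 1
  rw [left_rtmul, right_rtmul, mul_one, one_mul]
  simpa using rtmul_smul (1 : R) s 1

/-- The `S`-relative differential graded ring of forms with values in the Sweedler coring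
`R ⊗_S R` with the grouplike element `1 ⊗ 1`. -/
def sweedlerForms : RelDGRing.{u, v} S :=
  (sweedler φ).forms φ (sweedlerOne φ) (sweedlerOne_isGrouplike φ) (sweedlerOne_central φ)

/-! ### Relative differential forms -/

/-- The image of `S → R`, as an additive subgroup. -/
def imageSub : AddSubgroup R := φ.toAddMonoidHom.range

/-- The map of `R / S` induced by an additive map of `R` preserving the image of `S`. -/
def quotMap (f : R →+ R) (hf : ∀ s, ∃ t, f (φ s) = φ t) : R ⧸ imageSub φ →+ R ⧸ imageSub φ :=
  QuotientAddGroup.map _ _ f (by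
    rintro _ ⟨s, rfl⟩
    obtain ⟨t, ht⟩ := hf s
    exact ⟨t, ht.symm⟩)

/-- The cokernel `R / S` of `S → R`, as an `(S, S)`-bimodule. -/
def cokerBimod : Bimod.{v, v, u} S S :=
  letI l : Module S (R ⧸ imageSub φ) :=
    { smul := fun s => quotMap φ (AddMonoidHom.mulLeft (φ s)) (fun t => ⟨s * t, by simp⟩)
      one_smul := by
        rintro ⟨x⟩; exact congrArg (QuotientAddGroup.mk (s := imageSub φ)) (show φ 1 * x = x by simp)
      mul_smul := by
        rintro s t ⟨x⟩
        exact congrArg (QuotientAddGroup.mk (s := imageSub φ))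
          (show φ (s * t) * x = φ s * (φ t * x) by simp [mul_assoc])
      smul_zero := fun s => map_zero (quotMap φ _ _)
      smul_add := fun s => map_add (quotMap φ _ _)
      add_smul := by
        rintro s t ⟨x⟩
        exact congrArg (QuotientAddGroup.mk (s := imageSub φ))
          (show φ (s + t) * x = φ s * x + φ t * x by simp [add_mul])
      zero_smul := by
        rintro ⟨x⟩; exact congrArg (QuotientAddGroup.mk (s := imageSub φ)) (show φ 0 * x = 0 by simp) }
  letI r : Module Sᵐᵒᵖ (R ⧸ imageSub φ) :=
    { smul := fun s => quotMap φ (AddMonoidHom.mulRight (φ s.unop)) (fun t => ⟨t * s.unop, by simp⟩)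
      one_smul := by
        rintro ⟨x⟩; exact congrArg (QuotientAddGroup.mk (s := imageSub φ)) (show x * φ 1 = x by simp)
      mul_smul := by
        rintro s t ⟨x⟩
        exact congrArg (QuotientAddGroup.mk (s := imageSub φ))
          (show x * φ (t.unop * s.unop) = x * φ t.unop * φ s.unop by simp [mul_assoc])
      smul_zero := fun s => map_zero (quotMap φ _ _)
      smul_add := fun s => map_add (quotMap φ _ _)
      add_smul := by
        rintro s t ⟨x⟩
        exact congrArg (QuotientAddGroup.mk (s := imageSub φ))
          (show x * φ (s.unop + t.unop) = x * φ s.unop + x * φ t.unop by simp [mul_add])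
      zero_smul := by
        rintro ⟨x⟩; exact congrArg (QuotientAddGroup.mk (s := imageSub φ)) (show x * φ 0 = 0 by simp) }
  { carrier := R ⧸ imageSub φ
    left := l
    right := r
    comm := ⟨by
      rintro s t ⟨x⟩
      exact congrArg (QuotientAddGroup.mk (s := imageSub φ))
        (show φ s * (x * φ t.unop) = φ s * x * φ t.unop by rw [mul_assoc])⟩ }

/-- The projection `π : R → R / S`. -/
def proj : R →+ cokerBimod φ := QuotientAddGroup.mk' (imageSub φ)

theorem proj_surjective : Function.Surjective (proj φ) := QuotientAddGroup.mk'_surjective _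

theorem proj_left (s : S) (r : R) : proj φ (φ s * r) = s • proj φ r := rfl

theorem proj_right (s : S) (r : R) : proj φ (r * φ s) = op s • proj φ r := rfl

theorem proj_image (s : S) : proj φ (φ s) = 0 :=
  (QuotientAddGroup.eq_zero_iff _).2 ⟨s, rfl⟩

theorem proj_one : proj φ 1 = 0 := by simpa using proj_image φ 1

/-- Maps out of `R / S`. -/
def projLift {P : Type*} [AddCommGroup P] (f : R →+ P) (hf : ∀ s, f (φ s) = 0) :
    cokerBimod φ →+ P :=
  QuotientAddGroup.lift (imageSub φ) f (by rintro _ ⟨s, rfl⟩; exact hf s)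

@[simp] theorem projLift_proj {P : Type*} [AddCommGroup P] (f : R →+ P) (hf : ∀ s, f (φ s) = 0)
    (r : R) : projLift φ f hf (proj φ r) = f r := rfl

/-- The `(R, S)`-bimodule `Ωⁿ_S R = R ⊗_S R/S ⊗_S ⋯ ⊗_S R/S` (`n` factors `R/S`). -/
def relPow : ℕ → Bimod.{u, v, u} R S
  | 0 => resRight φ
  | n + 1 => Bimod.tensor (relPow n) (cokerBimod φ)

/-- An element of `R` in degree zero. -/
def relUnit : R →+ relPow φ 0 := AddMonoidHom.id R

/-- `relSnoc w q` is `w ⊗ q`. -/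
def relSnoc (n : ℕ) : relPow φ n →+ cokerBimod φ →+ relPow φ (n + 1) :=
  Bimod.tmul (relPow φ n) (cokerBimod φ)

variable {φ}

theorem relSnoc_smul {n : ℕ} (w : relPow φ n) (s : S) (q : cokerBimod φ) :
    relSnoc φ n (op s • w) q = relSnoc φ n w (s • q) := Bimod.tmul_smul w s q

theorem right_relSnoc {n : ℕ} (w : relPow φ n) (s : S) (q : cokerBimod φ) :
    op s • relSnoc φ n w q = relSnoc φ n w (op s • q) := rfl

theorem right_relUnit (s : S) (r : R) : op s • relUnit φ r = relUnit φ (r * φ s) := rfl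

/-- Maps out of `relPow φ (n + 1)`. -/
def relLift {P : Type*} [AddCommGroup P] {n : ℕ} (f : relPow φ n →+ cokerBimod φ →+ P)
    (hf : ∀ w (s : S) q, f (op s • w) q = f w (s • q)) : relPow φ (n + 1) →+ P :=
  Bimod.lift f hf

@[simp] theorem relLift_relSnoc {P : Type*} [AddCommGroup P] {n : ℕ}
    (f : relPow φ n →+ cokerBimod φ →+ P) (hf : ∀ w (s : S) q, f (op s • w) q = f w (s • q))
    (w : relPow φ n) (q : cokerBimod φ) : relLift f hf (relSnoc φ n w q) = f w q := rfl

@[elab_as_elim]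
theorem relPow_cases {n : ℕ} {p : relPow φ (n + 1) → Prop} (z : relPow φ (n + 1))
    (snoc : ∀ w r, p (relSnoc φ n w (proj φ r))) (add : ∀ x y, p x → p y → p (x + y)) : p z :=
  Bimod.tensor_induction z (fun w q => by
    obtain ⟨r, rfl⟩ := proj_surjective φ q
    exact snoc w r) add

end Extension

section Relative

variable {S : Type v} {R : Type u} [Ring S] [Ring R] {φ : S →+* R}

/-- The three properties of a right multiplication `W × R → W` compatible with `S`. -/
structure IsRelAct {n : ℕ} (f : relPow φ n →+ R →+ relPow φ n) : Prop where
  image : ∀ w s, f w (φ s) = op s • w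
  smul : ∀ w s a, f (op s • w) a = f w (φ s * a)
  mul : ∀ w a s, f w (a * φ s) = op s • f w a

/-- The map `(w, a, r) ↦ w ⊗ π(a r) - f(w, a) ⊗ π(r)`. -/
def relActPre {n : ℕ} (f : relPow φ n →+ R →+ relPow φ n) (w : relPow φ n) :
    R →+ R →+ relPow φ (n + 1) :=
  AddMonoidHom.mul.compr₂ ((relSnoc φ n w).comp (proj φ)) -
    ((relSnoc φ n).compl₂ (proj φ)).comp (f w)

theorem relActPre_apply {n : ℕ} (f : relPow φ n →+ R →+ relPow φ n) (w : relPow φ n) (a r : R) :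
    relActPre f w a r = relSnoc φ n w (proj φ (a * r)) - relSnoc φ n (f w a) (proj φ r) := rfl

/-- The map `(w ⊗ π(a), r) ↦ w ⊗ π(a r) - f(w, a) ⊗ π(r)`. -/
def relActStep {n : ℕ} (f : relPow φ n →+ R →+ relPow φ n) (hf : IsRelAct f) :
    relPow φ (n + 1) →+ R →+ relPow φ (n + 1) :=
  relLift (AddMonoidHom.mk' (fun w => projLift φ (relActPre f w) (fun s => by
      ext r
      rw [relActPre_apply, hf.image, relSnoc_smul, proj_left, sub_self]; rfl))
    (fun w w' => by
      ext q r
      obtain ⟨a, rfl⟩ := proj_surjective φ q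
      simp only [AddMonoidHom.add_apply, projLift_proj, relActPre_apply, map_add]
      abel))
    (fun w s q => by
      obtain ⟨a, rfl⟩ := proj_surjective φ q
      ext r
      change relActPre f (op s • w) a r = relActPre f w (φ s * a) r
      rw [relActPre_apply, relActPre_apply, relSnoc_smul, hf.smul, mul_assoc, proj_left])

theorem relActStep_apply {n : ℕ} (f : relPow φ n →+ R →+ relPow φ n) (hf : IsRelAct f)
    (w : relPow φ n) (a r : R) : relActStep f hf (relSnoc φ n w (proj φ a)) r =
      relSnoc φ n w (proj φ (a * r)) - relSnoc φ n (f w a) (proj φ r) := rfl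

theorem relActStep_isRelAct {n : ℕ} (f : relPow φ n →+ R →+ relPow φ n) (hf : IsRelAct f) :
    IsRelAct (relActStep f hf) where
  image w s := by
    induction w using relPow_cases with
    | snoc w a =>
      rw [relActStep_apply, proj_image, map_zero, sub_zero, proj_right, right_relSnoc]
    | add x y hx hy => rw [map_add, AddMonoidHom.add_apply, hx, hy, smul_add]
  smul w s r := by
    induction w using relPow_cases with
    | snoc w a =>
      rw [right_relSnoc, ← proj_right, relActStep_apply, relActStep_apply, hf.mul, relSnoc_smul,
        proj_left, mul_assoc]
    | add x y hx hy =>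
      rw [smul_add, map_add, map_add, AddMonoidHom.add_apply, AddMonoidHom.add_apply, hx, hy]
  mul w r s := by
    induction w using relPow_cases with
    | snoc w a =>
      rw [relActStep_apply, relActStep_apply, smul_sub, right_relSnoc, right_relSnoc, ← proj_right,
        ← proj_right, mul_assoc]
    | add x y hx hy => rw [map_add, AddMonoidHom.add_apply, AddMonoidHom.add_apply, hx, hy, smul_add]

/-- Multiplication by `R` from the right, with its properties. -/
def relActAux (φ : S →+* R) : ∀ n, {f : relPow φ n →+ R →+ relPow φ n // IsRelAct f}
  | 0 => ⟨(AddMonoidHom.mul : R →+ R →+ R),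
      ⟨fun _ _ => rfl, fun w s a => mul_assoc (show R from w) (φ s) a,
        fun w a s => (mul_assoc (show R from w) a (φ s)).symm⟩⟩
  | n + 1 => ⟨relActStep (relActAux φ n).1 (relActAux φ n).2,
      relActStep_isRelAct (relActAux φ n).1 (relActAux φ n).2⟩

/-- Multiplication of relative forms by elements of `R` from the right: in degree zero it is the
product of `R`, and `(w ⊗ π(a)) r = w ⊗ π(a r) - (w a) ⊗ π(r)`. Unfolding the recursion gives
`(r₀, …, rₙ) r = ∑ᵢ (-1)ⁿ⁻ⁱ (r₀, …, rᵢ rᵢ₊₁, …, rₙ, r)` with `rₙ₊₁ = r`. -/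
def relAct (φ : S →+* R) (n : ℕ) : relPow φ n →+ R →+ relPow φ n := (relActAux φ n).1

theorem relAct_isRelAct (n : ℕ) : IsRelAct (relAct φ n) := (relActAux φ n).2

theorem relAct_relUnit (a r : R) : relAct φ 0 (relUnit φ a) r = relUnit φ (a * r) := rfl

theorem relAct_relSnoc {n : ℕ} (w : relPow φ n) (a r : R) :
    relAct φ (n + 1) (relSnoc φ n w (proj φ a)) r =
      relSnoc φ n w (proj φ (a * r)) - relSnoc φ n (relAct φ n w a) (proj φ r) := rfl

theorem relAct_one {n : ℕ} (w : relPow φ n) : relAct φ n w 1 = w := by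
  rw [← map_one φ, (relAct_isRelAct n).image, MulOpposite.op_one, one_smul]

theorem relAct_mul {n : ℕ} (w : relPow φ n) (a b : R) :
    relAct φ n w (a * b) = relAct φ n (relAct φ n w a) b := by
  induction n generalizing a b with
  | zero => exact (mul_assoc (show R from w) a b).symm
  | succ n ih =>
    induction w using relPow_cases with
    | snoc w c =>
      rw [relAct_relSnoc, relAct_relSnoc, map_sub, AddMonoidHom.sub_apply, relAct_relSnoc,
        relAct_relSnoc, ih, mul_assoc]
      abel
    | add x y hx hy =>
      simp only [map_add, AddMonoidHom.add_apply, hx, hy]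

/-- The map `(x, w ⊗ q) ↦ f (x, w) ⊗ q`. -/
def relStep {P : Type*} [AddCommGroup P] {n k : ℕ} (f : P →+ relPow φ n →+ relPow φ k)
    (hf : ∀ x (s : S) w, f x (op s • w) = op s • f x w) :
    P →+ relPow φ (n + 1) →+ relPow φ (k + 1) :=
  AddMonoidHom.mk' (fun x => relLift ((relSnoc φ k).comp (f x))
    (fun w s q => by simp only [AddMonoidHom.comp_apply, hf]; exact relSnoc_smul _ _ _))
    (fun x y => Bimod.tensor_ext fun w q => by
      change relSnoc φ k (f (x + y) w) q = relSnoc φ k (f x w) q + relSnoc φ k (f y w) q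
      simp only [map_add, AddMonoidHom.add_apply])

theorem relStep_right {P : Type*} [AddCommGroup P] {n k : ℕ} (f : P →+ relPow φ n →+ relPow φ k)
    (hf : ∀ x (s : S) w, f x (op s • w) = op s • f x w) (x : P) (s : S) (w : relPow φ (n + 1)) :
    relStep f hf x (op s • w) = op s • relStep f hf x w := by
  induction w using relPow_cases with
  | snoc w r => rfl
  | add y z hy hz => rw [smul_add, map_add, map_add, hy, hz, smul_add]

/-- Multiplication of relative forms, with its right linearity. -/
def relMulAux (φ : S →+* R) (m : ℕ) : ∀ n, {f : relPow φ m →+ relPow φ n →+ relPow φ (m + n) //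
    ∀ x (s : S) w, f x (op s • w) = op s • f x w}
  | 0 => ⟨relAct φ m, fun x s w => (relAct_isRelAct m).mul x (show R from w) s⟩
  | n + 1 => ⟨relStep (relMulAux φ m n).1 (relMulAux φ m n).2,
      relStep_right (relMulAux φ m n).1 (relMulAux φ m n).2⟩

/-- Multiplication of relative forms: `w (r ⊗ q₁ ⊗ ⋯ ⊗ qₙ) = (w r) ⊗ q₁ ⊗ ⋯ ⊗ qₙ`. On pure
tensors this is the alternating sum of `relMul_relPure`. -/
def relMul (φ : S →+* R) (m n : ℕ) : relPow φ m →+ relPow φ n →+ relPow φ (m + n) := (relMulAux φ m n).1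

theorem relMul_relUnit {m : ℕ} (x : relPow φ m) (r : R) :
    relMul φ m 0 x (relUnit φ r) = relAct φ m x r := rfl

theorem relMul_relSnoc {m n : ℕ} (x : relPow φ m) (w : relPow φ n) (q : cokerBimod φ) :
    relMul φ m (n + 1) x (relSnoc φ n w q) = relSnoc φ (m + n) (relMul φ m n x w) q := rfl

theorem relMul_relAct {m n : ℕ} (x : relPow φ m) (w : relPow φ n) (r : R) :
    relMul φ m n x (relAct φ n w r) = relAct φ (m + n) (relMul φ m n x w) r := by
  induction n generalizing r with
  | zero => exact relAct_mul x (show R from w) r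
  | succ n ih =>
    induction w using relPow_cases with
    | snoc w a =>
      rw [relAct_relSnoc, map_sub, relMul_relSnoc, relMul_relSnoc, ih, relMul_relSnoc]
      exact (relAct_relSnoc (relMul φ m n x w) a r).symm
    | add y z hy hz =>
      simp only [map_add, AddMonoidHom.add_apply, hy, hz]

theorem gcast_relSnoc {m n : ℕ} (h : m = n) (x : relPow φ m) (q : cokerBimod φ) :
    gcast (A := fun n => relPow φ n) (congrArg (· + 1) h) (relSnoc φ m x q) =
      relSnoc φ n (gcast (A := fun n => relPow φ n) h x) q := by
  subst h; rfl

theorem relUnit_relMul (n : ℕ) (x : relPow φ n) :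
    gcast (A := fun n => relPow φ n) (Nat.zero_add n) (relMul φ 0 n (relUnit φ 1) x) = x := by
  induction n with
  | zero => exact one_mul (M := R) x
  | succ n ih =>
    induction x using relPow_cases with
    | snoc x r =>
      rw [relMul_relSnoc]
      exact (gcast_relSnoc (Nat.zero_add n) _ (proj φ r)).trans (by rw [ih])
    | add x y hx hy => rw [map_add, map_add, hx, hy]

theorem relMul_assoc (l m n : ℕ) (x : relPow φ l) (y : relPow φ m) (z : relPow φ n) :
    gcast (A := fun n => relPow φ n) (Nat.add_assoc l m n) (relMul φ _ _ (relMul φ _ _ x y) z) =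
      relMul φ _ _ x (relMul φ _ _ y z) := by
  induction n with
  | zero => exact (relMul_relAct x y (show R from z)).symm
  | succ n ih =>
    induction z using relPow_cases with
    | snoc z r =>
      rw [relMul_relSnoc, relMul_relSnoc]
      exact (gcast_relSnoc (Nat.add_assoc l m n) _ (proj φ r)).trans (by rw [ih]; rfl)
    | add z w hz hw => rw [map_add, map_add, hz, hw, map_add, map_add]

/-- The graded ring of relative forms. -/
@[reducible] def relRing (φ : S →+* R) : DirectSum.GRing (fun n => relPow φ n) :=
  gringMk (relMul φ) (relUnit φ 1) relUnit_relMul (fun _ x => relAct_one x) relMul_assoc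

/-- The differential of relative forms, with its right linearity. -/
def relDAux (φ : S →+* R) : ∀ n, {f : relPow φ n →+ relPow φ (n + 1) // ∀ (s : S) w, f (op s • w) = op s • f w}
  | 0 => ⟨(relSnoc φ 0 (relUnit φ 1)).comp (proj φ), fun _ _ => rfl⟩
  | n + 1 => ⟨relLift ((relSnoc φ (n + 1)).comp (relDAux φ n).1) (fun w s q => by
        simp only [AddMonoidHom.comp_apply, (relDAux φ n).2]
        exact relSnoc_smul _ _ _), fun s w => by
      induction w using relPow_cases with
      | snoc w r => rfl
      | add y z hy hz => rw [smul_add, map_add, map_add, hy, hz, smul_add]⟩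

/-- The differential `d (r₀ ⊗ q₁ ⊗ ⋯ ⊗ qₙ) = 1 ⊗ π(r₀) ⊗ q₁ ⊗ ⋯ ⊗ qₙ`. -/
def relD (φ : S →+* R) (n : ℕ) : relPow φ n →+ relPow φ (n + 1) := (relDAux φ n).1

theorem relD_relUnit (r : R) : relD φ 0 (relUnit φ r) = relSnoc φ 0 (relUnit φ 1) (proj φ r) := rfl

theorem relD_relSnoc {n : ℕ} (w : relPow φ n) (q : cokerBimod φ) :
    relD φ (n + 1) (relSnoc φ n w q) = relSnoc φ (n + 1) (relD φ n w) q := rfl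

theorem relD_relD (n : ℕ) (w : relPow φ n) : relD φ (n + 1) (relD φ n w) = 0 := by
  induction n with
  | zero =>
    change relD φ 1 (relSnoc φ 0 (relUnit φ 1) (proj φ (show R from w))) = 0
    rw [relD_relSnoc, relD_relUnit, proj_one, map_zero, map_zero]; rfl
  | succ n ih =>
    induction w using relPow_cases with
    | snoc w r => rw [relD_relSnoc, relD_relSnoc, ih, map_zero]; rfl
    | add y z hy hz => rw [map_add, map_add, hy, hz, add_zero]

theorem relD_relAct {n : ℕ} (w : relPow φ n) (r : R) :
    relD φ n (relAct φ n w r) =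
      relAct φ (n + 1) (relD φ n w) r + (-1 : ℤ) ^ n • relSnoc φ n w (proj φ r) := by
  induction n generalizing r with
  | zero =>
    change relSnoc φ 0 (relUnit φ 1) (proj φ ((show R from w) * r)) =
      relAct φ 1 (relSnoc φ 0 (relUnit φ 1) (proj φ (show R from w))) r + (1 : ℤ) • _
    rw [relAct_relSnoc, relAct_relUnit, one_mul, one_smul]
    exact (sub_add_cancel _ _).symm
  | succ n ih =>
    induction w using relPow_cases with
    | snoc w a =>
      rw [relAct_relSnoc, map_sub, relD_relSnoc, relD_relSnoc, relD_relSnoc, relAct_relSnoc, ih]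
      simp only [map_add, map_zsmul, AddMonoidHom.add_apply, AddMonoidHom.zsmul_apply, pow_succ,
        mul_neg, mul_one, neg_smul]
      abel
    | add y z hy hz =>
      simp only [map_add, AddMonoidHom.add_apply, hy, hz, smul_add]
      abel

theorem relD_mul (m n : ℕ) (x : relPow φ m) (y : relPow φ n) :
    relD φ (m + n) (relMul φ m n x y) =
      gcast (A := fun n => relPow φ n) (Nat.succ_add m n) (relMul φ (m + 1) n (relD φ m x) y) +
      (-1 : ℤ) ^ m • relMul φ m (n + 1) x (relD φ n y) := by
  induction n with
  | zero =>
    refine (relD_relAct x (show R from y)).trans ?_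
    have h : relMul φ m 1 x (relD φ 0 y) = relSnoc φ m x (proj φ (show R from y)) := by
      change relSnoc φ m (relAct φ m x 1) (proj φ (show R from y)) = _
      rw [relAct_one]
    exact congrArg (relAct φ (m + 1) (relD φ m x) (show R from y) + (-1 : ℤ) ^ m • ·) h.symm
  | succ n ih =>
    induction y using relPow_cases with
    | snoc y r =>
      rw [relMul_relSnoc, relMul_relSnoc, relD_relSnoc]
      refine (relD_relSnoc (relMul φ m n x y) (proj φ r)).trans ?_
      rw [ih, map_add, AddMonoidHom.add_apply, map_zsmul, AddMonoidHom.zsmul_apply]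
      exact congrArg₂ (· + ·) (gcast_relSnoc (Nat.succ_add m n) _ (proj φ r)).symm rfl
    | add y z hy hz =>
      simp only [map_add, smul_add]
      refine (congrArg₂ (· + ·) hy hz).trans ?_
      exact add_add_add_comm _ _ _ _

/-- The pure tensor `(r₀, r₁, …, rₙ) = r₀ ⊗ π(r₁) ⊗ ⋯ ⊗ π(rₙ)`. -/
def relPure (φ : S →+* R) (r : ℕ → R) : ∀ n, relPow φ n
  | 0 => relUnit φ (r 0)
  | n + 1 => relSnoc φ n (relPure φ r n) (proj φ (r (n + 1)))

/-- The sequence `(r₀, …, rᵢ rᵢ₊₁, rᵢ₊₂, …)`. -/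
def contract (r : ℕ → R) (i j : ℕ) : R :=
  if j < i then r j else if j = i then r i * r (i + 1) else r (j + 1)

theorem relPure_congr {r r' : ℕ → R} {n : ℕ} (h : ∀ j ≤ n, r j = r' j) :
    relPure φ r n = relPure φ r' n := by
  induction n with
  | zero => exact congrArg (relUnit φ) (h 0 le_rfl)
  | succ n ih =>
    rw [relPure, relPure, ih (fun j hj => h j (hj.trans n.le_succ)), h (n + 1) le_rfl]

theorem relAct_relPure (r : ℕ → R) (n : ℕ) :
    relAct φ n (relPure φ r n) (r (n + 1)) =
      ∑ i ∈ Finset.range (n + 1), (-1 : ℤ) ^ (n - i) • relPure φ (contract r i) n := by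
  induction n with
  | zero => simp [relPure, relAct_relUnit, contract]
  | succ n ih =>
    rw [relPure, relAct_relSnoc, ih, Finset.sum_range_succ _ (n + 1), Nat.sub_self, pow_zero,
      one_smul, sub_eq_add_neg]
    refine (add_comm _ _).trans (congrArg₂ (· + ·) ?_ ?_)
    rotate_left
    · rw [relPure, relPure_congr (r := contract r (n + 1)) (r' := r)]
      · simp [contract]
      · intro j hj
        simp [contract, Nat.lt_succ_of_le hj]
    · rw [map_sum, AddMonoidHom.finsetSum_apply, ← Finset.sum_neg_distrib]
      refine Finset.sum_congr rfl fun i hi => ?_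
      have hi' : i ≤ n := Nat.lt_succ_iff.1 (Finset.mem_range.1 hi)
      have h : contract r i (n + 1) = r (n + 2) := by
        unfold contract
        rw [if_neg (by omega), if_neg (by omega)]
      rw [map_zsmul, AddMonoidHom.zsmul_apply, relPure, h, Nat.succ_sub hi', pow_succ, mul_neg,
        mul_one, neg_smul]

/-- The product of pure tensors:
`(r₀, …, rₙ) (rₙ₊₁, …, rₙ₊₁₊ₘ) = ∑ᵢ (-1)ⁿ⁻ⁱ (r₀, …, rᵢ rᵢ₊₁, …, rₙ₊₁₊ₘ)`, over `0 ≤ i ≤ n`. -/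
theorem relMul_relPure (r : ℕ → R) (n m : ℕ) :
    relMul φ n m (relPure φ r n) (relPure φ (fun j => r (n + 1 + j)) m) =
      ∑ i ∈ Finset.range (n + 1), (-1 : ℤ) ^ (n - i) • relPure φ (contract r i) (n + m) := by
  induction m with
  | zero => exact relAct_relPure r n
  | succ m ih =>
    rw [relPure, relMul_relSnoc, ih, map_sum, AddMonoidHom.finsetSum_apply]
    refine Finset.sum_congr rfl fun i hi => ?_
    have hi' : i ≤ n := Nat.lt_succ_iff.1 (Finset.mem_range.1 hi)
    have h : contract r i (n + m + 1) = r (n + 1 + (m + 1)) := by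
      unfold contract
      rw [if_neg (by omega), if_neg (by omega)]
      congr 1; omega
    rw [map_zsmul, AddMonoidHom.zsmul_apply, ← h]
    rfl

/-- The differential of a pure tensor: `d (r₀, …, rₙ) = (1, r₀, …, rₙ)`. -/
theorem relD_relPure (r : ℕ → R) (n : ℕ) :
    relD φ n (relPure φ r n) = relPure φ (fun j => if j = 0 then 1 else r (j - 1)) (n + 1) := by
  induction n with
  | zero => rfl
  | succ n ih => rw [relPure, relD_relSnoc, ih]; rfl

/-- The `S`-relative differential graded ring `Ω_S R` of relative differential forms of a ring
extension `S → R`. -/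
def relForms (φ : S →+* R) : RelDGRing.{u, v} S :=
  letI := relRing φ
  { Ω := fun n => relPow φ n
    d := relD φ
    d_d := relD_relD
    leibniz := fun m n x y => leibniz_of_gcast (relD_mul m n x y)
    η := degZeroHom (A := fun n => relPow φ n)
      ((relUnit φ).comp φ.toAddMonoidHom)
      (congrArg (relUnit φ) (map_one φ))
      (fun s t => congrArg (relUnit φ) (map_mul φ s t))
    d_η := fun s => by
      change relSnoc φ 0 (relUnit φ 1) (proj φ (φ s)) = 0
      rw [proj_image, map_zero] }

end Relative

end CoringForms

end

open MulOpposite (op)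

noncomputable section

namespace CoringForms

universe u v

/-! ### The derivation `r ↦ g r - r g` attached to a grouplike element. -/

section DZero

variable {R : Type u} [Ring R] {𝒞 : Coring R} {g : 𝒞.C} (hg : 𝒞.IsGrouplike g)

/-! Write `d r = g r - r g`. Being a commutator with `g`, this is a derivation `R → ker ε`. For `g =
1 ⊗ 1` it reads `d r = 1 ⊗ r - r ⊗ 1`, and it kills the image of `S`, which commutes with `g`. By
the Leibniz rule it therefore descends to an `(S, S)`-bilinear map `R/S → ker ε` (`univDerBar`).

In degree one, `c ↦ c - ε(c) g` is a left linear projection of `R ⊗_S R` onto `ker ε`, and it sends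
`a ⊗ b` to `a d(b)` (`projL_rtmul`). So the elements `a d(b)` span `ker ε`. Moreover `a ⊗ π(b) ↦ a
d(b)` is a bijection `R ⊗_S R/S → ker ε`, with inverse the restriction to `ker ε` of `a ⊗ b ↦ a ⊗
π(b)`. Iterating over the tensor factors gives the bijection `r₀ ⊗ π(r₁) ⊗ ⋯ ⊗ π(rₙ) ↦ r₀ d(r₁) ⊗ ⋯
⊗ d(rₙ)`, which is `relToTens`.

This map respects the structure for two reasons. Products: right multiplication on `ker ε` satisfies
`d(a) r = d(a r) - a d(r)`, which is exactly the recursion defining the right action of `R` on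
relative forms (`relToTens_relAct`). Differentials: each `d r` is closed, so `r₀ d(r₁) ⊗ ⋯ ⊗ d(rₙ)`
has differential `d(r₀) ⊗ d(r₁) ⊗ ⋯ ⊗ d(rₙ)` (`Coring.formsD_snoc_dZero`).

The inverse `tensToRel` is built one factor at a time from `(w, a ⊗ b) ↦ w a ⊗ π(b)`. The next
factor over `R` can be attached only if the map so far is right `R`-linear. On all of `R ⊗_S R` this
fails, but the defect is governed by the counit and vanishes on `ker ε` (`relSweedler_op_smul`). -/

theorem Coring.kerIncl_dZero (r : R) :
    𝒞.kerIncl (Coring.dZero hg r) = op r • g - r • g := rfl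

theorem Coring.dZero_add (r r' : R) :
    Coring.dZero hg (r + r') = Coring.dZero hg r + Coring.dZero hg r' := by
  apply 𝒞.kerIncl_injective
  simp only [map_add, Coring.kerIncl_dZero, add_smul, MulOpposite.op_add]
  abel

/-- The Leibniz rule for a commutator: the two copies of `r g r'` cancel. Every later compatibility
with scalars rests on this identity. -/
theorem Coring.dZero_mul (r r' : R) :
    Coring.dZero hg (r * r') = op r' • Coring.dZero hg r + r • Coring.dZero hg r' := by
  apply 𝒞.kerIncl_injective
  rw [map_add, BimodHom.left, BimodHom.right]
  simp only [Coring.kerIncl_dZero, smul_sub, mul_smul, MulOpposite.op_mul, smul_comm r (op r')]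
  abel

/-- Exact one-forms are closed. As `g` is grouplike, `Δ(g r - r g) = g ⊗ g r - r g ⊗ g`. The outer
terms of `delta` cancel this, and leave `g r ⊗ g - g ⊗ r g`, which is zero because the tensor
product is balanced over `R` (the equation `e`). -/
theorem Coring.delta_dZero (r : R) : 𝒞.delta g (𝒞.kerIncl (Coring.dZero hg r)) = 0 := by
  have e : Bimod.tmul 𝒞.C 𝒞.C (op r • g) g = Bimod.tmul 𝒞.C 𝒞.C g (r • g) :=
    Bimod.tmul_smul g r g
  rw [Coring.delta_apply, Coring.kerIncl_dZero]
  simp only [map_sub, AddMonoidHom.sub_apply, 𝒞.Δ.left, 𝒞.Δ.right, hg.comul,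
    Bimod.left_tmul, Bimod.right_tmul, e]
  abel

/-- `formsD` is known only through its image in the tensor ring of the coring, so this identity and
the next are compared there, using that the tensor powers of `ker ε` embed in those of the coring.
-/
theorem Coring.formsD_unitR (r : R) :
    Coring.formsD hg 0 (unitR 𝒞.kerCounit r) =
      snoc 𝒞.kerCounit 0 (unitR 𝒞.kerCounit 1) (Coring.dZero hg r) := by
  apply Coring.incl_injective hg
  rw [Coring.incl_formsD]
  exact 𝒞.amitsur_unitR g r

/-- Leibniz for the Amitsur differential with a closed last factor: the term `± x ⊗ delta(d r)`
disappears. This has the same shape as the recursion `relD_relSnoc` for relative forms. -/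
theorem Coring.formsD_snoc_dZero {n : ℕ} (x : tpow 𝒞.kerCounit n) (r : R) :
    Coring.formsD hg (n + 1) (snoc 𝒞.kerCounit n x (Coring.dZero hg r)) =
      snoc 𝒞.kerCounit (n + 1) (Coring.formsD hg n x) (Coring.dZero hg r) := by
  have e : ∀ (m : ℕ) (y : tpow 𝒞.kerCounit m) k,
      𝒞.incl (m + 1) (snoc _ m y k) = snoc 𝒞.C m (𝒞.incl m y) (𝒞.kerIncl k) :=
    fun _ _ _ => rfl
  apply Coring.incl_injective hg
  rw [Coring.incl_formsD, e, e, Coring.amitsur_snoc, Coring.delta_dZero, Coring.incl_formsD,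
    map_zero, smul_zero, add_zero]

end DZero

/-! ### The derivation `R → ker ε` of the Sweedler coring, and its descent to `R/S`. -/

section Extension

variable {S : Type v} {R : Type u} [Ring S] [Ring R] (φ : S →+* R)

/-- The kernel of the counit of the Sweedler coring. -/
abbrev sweedlerKer : Bimod.{u, u, u} R R := (sweedler φ).kerCounit

/-- The element `1 ⊗ r - r ⊗ 1` of the kernel of the counit. -/
def univDer : R →+ sweedlerKer φ :=
  AddMonoidHom.mk' (Coring.dZero (sweedlerOne_isGrouplike φ)) (Coring.dZero_add _)

theorem univDer_mul (r r' : R) :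
    univDer φ (r * r') = op r' • univDer φ r + r • univDer φ r' :=
  Coring.dZero_mul (sweedlerOne_isGrouplike φ) r r'

/-- The element `1 ⊗_S 1` commutes with the image of `S`, since `S` can be moved across `⊗_S`. -/
theorem univDer_image (s : S) : univDer φ (φ s) = 0 :=
  (sweedler φ).kerIncl_injective (by
    refine (Coring.kerIncl_dZero (sweedlerOne_isGrouplike φ) (φ s)).trans ?_
    rw [sweedlerOne_central, sub_self, map_zero])

/-- The identity `r ⊗ r' - r r' ⊗ 1 = r (1 ⊗ r' - r' ⊗ 1)`. Since `projL` fixes `ker ε`, it shows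
that `ker ε` is generated by exact elements as a left module. It is what makes `relToTens`
surjective. -/
theorem projL_rtmul (r r' : R) :
    Coring.projL (sweedlerOne_isGrouplike φ) (rtmul φ r r') = r • univDer φ r' := by
  apply (sweedler φ).kerIncl_injective
  refine Eq.trans ?_ ((sweedler φ).kerIncl.left r (univDer φ r')).symm
  -- The factors `1` come from letting scalars act on the grouplike element `1 ⊗ 1`.
  change rtmul φ r r' - rtmul φ (r * r' * 1) 1 =
    r • (rtmul φ 1 (1 * r') - rtmul φ (r' * 1) 1)
  rw [smul_sub, left_rtmul, left_rtmul]
  simp only [mul_one, one_mul]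

/-- The map `R / S → ker ε` induced by `univDer`. -/
def univDerBar : cokerBimod φ →+ sweedlerKer φ := projLift φ (univDer φ) (univDer_image φ)

theorem univDerBar_proj (r : R) : univDerBar φ (proj φ r) = univDer φ r := rfl

/-- Leibniz for `φ s * r`: the term containing `univDer φ (φ s)` vanishes. The right-handed version
below is the same with the factors exchanged. -/
theorem univDerBar_smul (s : S) (q : cokerBimod φ) :
    univDerBar φ (s • q) = φ s • univDerBar φ q := by
  obtain ⟨r, rfl⟩ := proj_surjective φ q
  rw [← proj_left, univDerBar_proj, univDerBar_proj, univDer_mul, univDer_image, smul_zero,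
    zero_add]

theorem univDerBar_op_smul (s : S) (q : cokerBimod φ) :
    univDerBar φ (op s • q) = op (φ s) • univDerBar φ q := by
  obtain ⟨r, rfl⟩ := proj_surjective φ q
  rw [← proj_right, univDerBar_proj, univDerBar_proj, univDer_mul, univDer_image, smul_zero,
    add_zero]

/-! ### From relative forms to tensor powers of `ker ε`. -/

/-- `relToTens`, with its right linearity. -/
def relToTensAux : ∀ n, {f : relPow φ n →+ tpow (sweedlerKer φ) n //
    ∀ (s : S) w, f (op s • w) = op (φ s) • f w}
  | 0 => ⟨AddMonoidHom.id R, fun _ _ => rfl⟩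
  | n + 1 => ⟨relLift (((snoc (sweedlerKer φ) n).compl₂ (univDerBar φ)).comp (relToTensAux n).1)
      (fun w s q => by
        change snoc _ n ((relToTensAux n).1 (op s • w)) (univDerBar φ q) =
          snoc _ n ((relToTensAux n).1 w) (univDerBar φ (s • q))
        -- Balance over `S`: right linearity in degree `n` brings `φ s` out, `⊗_R` moves it across,
        -- and left linearity of `univDerBar` absorbs it. This is why the linearity is carried along
        -- the recursion.
        rw [(relToTensAux n).2, snoc_smul, univDerBar_smul]), fun s w => by
      induction w using relPow_cases with
      | snoc w r =>
        change snoc _ n ((relToTensAux n).1 w) (univDerBar φ (op s • proj φ r)) = _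
        rw [univDerBar_op_smul]; rfl
      | add x y hx hy => rw [smul_add, map_add, map_add, hx, hy, smul_add]⟩

/-- The map `r₀ ⊗ π(r₁) ⊗ ⋯ ⊗ π(rₙ) ↦ r₀ d(r₁) ⊗ ⋯ ⊗ d(rₙ)` from relative forms to the tensor
powers of the kernel of the counit. -/
def relToTens (n : ℕ) : relPow φ n →+ tpow (sweedlerKer φ) n := (relToTensAux φ n).1

theorem relToTens_relSnoc {n : ℕ} (w : relPow φ n) (r : R) :
    relToTens φ (n + 1) (relSnoc φ n w (proj φ r)) =
      snoc _ n (relToTens φ n w) (univDer φ r) := rfl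

/-- Here the twisted right action on relative forms becomes the evident one on the last tensor
factor. With `x` the image of `w`, the form `w ⊗ π(a)` times `r` goes to `x ⊗ d(a r) - x a ⊗ d(r)`.
Moving `a` across `⊗_R` and applying Leibniz leaves `x ⊗ d(a) r`. -/
theorem relToTens_relAct {n : ℕ} (w : relPow φ n) (r : R) :
    relToTens φ n (relAct φ n w r) = op r • relToTens φ n w := by
  induction n generalizing r with
  | zero => rfl
  | succ n ih =>
    induction w using relPow_cases with
    | snoc w a =>
      rw [relAct_relSnoc, map_sub, relToTens_relSnoc, relToTens_relSnoc, relToTens_relSnoc, ih,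
        snoc_smul, univDer_mul, map_add, right_snoc, add_sub_cancel_right]
    | add x y hx hy => rw [map_add, AddMonoidHom.add_apply, map_add, map_add, hx, hy, smul_add]

/-- Both products pass through the trailing factors of `y` unchanged, so only the action of its
leading coefficient in `R` is at stake, and that is `relToTens_relAct`. -/
theorem relToTens_relMul (m n : ℕ) (x : relPow φ m) (y : relPow φ n) :
    relToTens φ (m + n) (relMul φ m n x y) =
      tensMul m n (relToTens φ m x) (relToTens φ n y) := by
  induction n with
  | zero => exact relToTens_relAct φ x (show R from y)
  | succ n ih =>
    induction y using relPow_cases with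
    | snoc y r =>
      rw [relMul_relSnoc, relToTens_relSnoc, tensMul_snoc, ← ih]
      -- The degrees `m + (n + 1)` and `(m + n) + 1` agree by definition, so no transport between
      -- components is needed.
      exact relToTens_relSnoc φ (relMul φ m n x y) r
    | add y z hy hz => simp only [map_add, ← hy, ← hz]

/-- Both differentials act only on the leading coefficient once the trailing factors are exact. The
induction peels these off, ending with `r ↦ d r` in degree zero. -/
theorem relToTens_relD (n : ℕ) (w : relPow φ n) :
    relToTens φ (n + 1) (relD φ n w) =
      Coring.formsD (sweedlerOne_isGrouplike φ) n (relToTens φ n w) := by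
  induction n with
  | zero => exact (Coring.formsD_unitR (sweedlerOne_isGrouplike φ) (show R from w)).symm
  | succ n ih =>
    induction w using relPow_cases with
    | snoc w r =>
      rw [relD_relSnoc, relToTens_relSnoc, relToTens_relSnoc, ih]
      exact (Coring.formsD_snoc_dZero (sweedlerOne_isGrouplike φ) _ r).symm
    | add x y hx hy => simp only [map_add, hx, hy]

/-! ### The inverse map, from tensor powers of `ker ε` to relative forms. -/

/-- The map `(w, a ⊗ b) ↦ w a ⊗ π(b)`. -/
def relSweedler (n : ℕ) : relPow φ n →+ (sweedler φ).C →+ relPow φ (n + 1) :=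
  AddMonoidHom.mk' (fun w => rlift
      (((relSnoc φ n).compl₂ (proj φ)).comp (relAct φ n w)) (fun r s r' => by
        change relSnoc φ n (relAct φ n w (r * φ s)) (proj φ r') =
          relSnoc φ n (relAct φ n w r) (proj φ (φ s * r'))
        -- Right multiplication by `φ s` on relative forms is the given right `S`-action, so `s` can
        -- cross `⊗_S` into `R/S`.
        rw [(relAct_isRelAct n).mul, relSnoc_smul, proj_left]))
    (fun w w' => Bimod.tensor_ext fun a b => by
      change relSnoc φ n (relAct φ n (w + w') a) (proj φ b) =
        relSnoc φ n (relAct φ n w a) (proj φ b) + relSnoc φ n (relAct φ n w' a) (proj φ b)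
      rw [map_add (relAct φ n)]
      exact congrArg (fun f => f (proj φ b)) (map_add (relSnoc φ n) _ _))

theorem relSweedler_rtmul {n : ℕ} (w : relPow φ n) (a b : R) :
    relSweedler φ n w (rtmul φ a b) = relSnoc φ n (relAct φ n w a) (proj φ b) := rfl

/-- Associativity of the right action, `(w r) a = w (r a)`. It provides the balance over `R` that
`tensToRelAux` needs to descend to `⊗_R`. -/
theorem relSweedler_relAct {n : ℕ} (w : relPow φ n) (r : R) (c : (sweedler φ).C) :
    relSweedler φ n (relAct φ n w r) c = relSweedler φ n w (r • c) := by
  refine sweedler_induction (p := fun c => relSweedler φ n (relAct φ n w r) c =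
    relSweedler φ n w (r • (c : (sweedler φ).C))) c (fun a b => ?_) (fun x y hx hy => ?_)
  · exact congrArg (relSnoc φ n · (proj φ b)) (relAct_mul w r a).symm
  · exact ((map_add (relSweedler φ n (relAct φ n w r)) x y).trans (congrArg₂ (· + ·) hx hy)).trans
      ((map_add (relSweedler φ n w) (r • x) (r • y)).symm.trans
        (congrArg (relSweedler φ n w) (smul_add r x y).symm))

/-- The recursion for the right action, read backwards: `w a ⊗ π(b r) = (w a ⊗ π(b)) r + w a b ⊗
π(r)`, where `a b` is the counit of `a ⊗ b`. The last term is the obstruction to right linearity,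
and it is zero on `ker ε`. -/
theorem relSweedler_op_smul {n : ℕ} (w : relPow φ n) (r : R) (c : (sweedler φ).C) :
    relSweedler φ n w (op r • c) = relAct φ (n + 1) (relSweedler φ n w c) r +
      relSnoc φ n (relAct φ n w ((sweedler φ).counit c)) (proj φ r) := by
  refine sweedler_induction (p := fun c => relSweedler φ n w (op r • (c : (sweedler φ).C)) =
    relAct φ (n + 1) (relSweedler φ n w c) r +
      relSnoc φ n (relAct φ n w ((sweedler φ).counit c)) (proj φ r)) c
    (fun a b => ?_) (fun x y hx hy => ?_)
  · change relSnoc φ n (relAct φ n w a) (proj φ (b * r)) =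
      relAct φ (n + 1) (relSnoc φ n (relAct φ n w a) (proj φ b)) r +
        relSnoc φ n (relAct φ n w (a * b)) (proj φ r)
    rw [relAct_relSnoc, relAct_mul, sub_add_cancel]
  · change (sweedler φ).C at x y
    change relSweedler φ n w (op r • (x + y)) = relAct φ (n + 1) (relSweedler φ n w (x + y)) r +
      relSnoc φ n (relAct φ n w ((sweedler φ).counit (x + y))) (proj φ r)
    rw [smul_add]
    simp only [map_add, AddMonoidHom.add_apply]
    refine (congrArg₂ (· + ·) hx hy).trans ?_
    abel

/-- On `a ⊗ b`, with `x` the image of `w`, both sides are `x a ⊗ d(b) = x ⊗ a d(b)`. For `c` in `ker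
ε` the projection does nothing, which gives the inductive step of `relToTens_tensToRel`. -/
theorem relToTens_relSweedler {n : ℕ} (w : relPow φ n) (c : (sweedler φ).C) :
    relToTens φ (n + 1) (relSweedler φ n w c) =
      snoc _ n (relToTens φ n w) (Coring.projL (sweedlerOne_isGrouplike φ) c) := by
  refine sweedler_induction (p := fun c => relToTens φ (n + 1) (relSweedler φ n w c) =
      snoc _ n (relToTens φ n w) (Coring.projL (sweedlerOne_isGrouplike φ) c)) c
    (fun a b => ?_) (fun x y hx hy => ?_)
  · rw [projL_rtmul, relSweedler_rtmul, relToTens_relSnoc, relToTens_relAct, snoc_smul]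
  · change (sweedler φ).C at x y
    change relToTens φ (n + 1) (relSweedler φ n w (x + y)) =
      snoc _ n (relToTens φ n w) (Coring.projL (sweedlerOne_isGrouplike φ) (x + y))
    simp only [map_add, hx, hy]

/-- Of the two terms of `1 ⊗ r - r ⊗ 1`, the second dies because `π(1) = 0`. -/
theorem relSweedler_univDer {n : ℕ} (w : relPow φ n) (r : R) :
    relSweedler φ n w ((sweedler φ).kerIncl (univDer φ r)) = relSnoc φ n w (proj φ r) := by
  change relSweedler φ n w (rtmul φ 1 (1 * r) - rtmul φ (r * 1) 1) = _
  refine (map_sub (relSweedler φ n w) _ _).trans ?_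
  rw [relSweedler_rtmul, relSweedler_rtmul, relAct_one, proj_one, map_zero, sub_zero, one_mul]

/-- `tensToRel`, with its right linearity. -/
def tensToRelAux : ∀ n, {f : tpow (sweedlerKer φ) n →+ relPow φ n //
    ∀ (r : R) x, f (op r • x) = relAct φ n (f x) r}
  | 0 => ⟨AddMonoidHom.id R, fun _ _ => rfl⟩
  | n + 1 => ⟨snocLift
      (((relSweedler φ n).compl₂ (sweedler φ).kerIncl.toAddMonoidHom).comp (tensToRelAux n).1)
      (fun x r k => by
        change relSweedler φ n ((tensToRelAux n).1 (op r • x)) ((sweedler φ).kerIncl k) =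
          relSweedler φ n ((tensToRelAux n).1 x) ((sweedler φ).kerIncl (r • k))
        rw [(tensToRelAux n).2, relSweedler_relAct, BimodHom.left]), fun r x => by
      induction x using tpow_cases with
      | snoc x k =>
        change relSweedler φ n ((tensToRelAux n).1 x) ((sweedler φ).kerIncl (op r • k)) =
          relAct φ (n + 1) (relSweedler φ n ((tensToRelAux n).1 x) ((sweedler φ).kerIncl k)) r
        -- The only place in the construction where `k` must lie in `ker ε`: the counit defect drops
        -- out, and right linearity passes to degree `n + 1`.
        rw [BimodHom.right, relSweedler_op_smul, Coring.counit_kerIncl]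
        simp only [map_zero, AddMonoidHom.zero_apply, add_zero]
      | add x y hx hy =>
        rw [smul_add, map_add, map_add, hx, hy, map_add, AddMonoidHom.add_apply]⟩

/-- The map from the tensor powers of the kernel of the counit to relative forms that multiplies
the relative one-forms `∑ a ⊗ π(b)` of the factors `∑ a ⊗ b`. -/
def tensToRel (n : ℕ) : tpow (sweedlerKer φ) n →+ relPow φ n := (tensToRelAux φ n).1

theorem tensToRel_snoc {n : ℕ} (x : tpow (sweedlerKer φ) n) (k : sweedlerKer φ) :
    tensToRel φ (n + 1) (snoc _ n x k) =
      relSweedler φ n (tensToRel φ n x) ((sweedler φ).kerIncl k) := rfl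

/-- Factor by factor, `π(r)` goes to `1 ⊗ r - r ⊗ 1` and back to `π(r)`. -/
theorem tensToRel_relToTens (n : ℕ) (w : relPow φ n) : tensToRel φ n (relToTens φ n w) = w := by
  induction n with
  | zero => rfl
  | succ n ih =>
    induction w using relPow_cases with
    | snoc w r => rw [relToTens_relSnoc, tensToRel_snoc, ih, relSweedler_univDer]
    | add x y hx hy => rw [map_add, map_add, hx, hy]

/-- Factor by factor, the round trip applies the projection `projL`, which is the identity on `ker
ε`. -/
theorem relToTens_tensToRel (n : ℕ) (x : tpow (sweedlerKer φ) n) :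
    relToTens φ n (tensToRel φ n x) = x := by
  induction n with
  | zero => rfl
  | succ n ih =>
    induction x using tpow_cases with
    | snoc x k => rw [tensToRel_snoc, relToTens_relSweedler, ih, Coring.projL_kerIncl]
    | add x y hx hy => rw [map_add, map_add, hx, hy]

/-! ### The isomorphism of relative differential graded rings. -/

/-- The tensor powers of the kernel of the counit are the groups of relative forms. -/
def tensEquivRel (n : ℕ) : tpow (sweedlerKer φ) n ≃+ relPow φ n where
  toFun := tensToRel φ n
  invFun := relToTens φ n
  left_inv := relToTens_tensToRel φ n
  right_inv := tensToRel_relToTens φ n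
  map_add' := map_add (tensToRel φ n)

/-- The isomorphism of `Ω(R ⊗_S R / S)` with `Ω_S R`. -/
def sweedlerFormsIso : RelDGRing.Iso (sweedlerForms φ) (relForms φ) where
  equiv := tensEquivRel φ
  map_mul m n x y := by
    -- Multiplicativity is known for `relToTens`, so both sides are pulled back along it. The
    -- inverse of a multiplicative bijection is multiplicative, and `tensToRel` needs no computation
    -- of its own.
    apply (tensEquivRel φ (m + n)).symm.injective
    refine ((tensEquivRel φ (m + n)).symm_apply_apply _).trans ?_
    refine Eq.trans ?_ (relToTens_relMul φ m n (tensToRel φ m x) (tensToRel φ n y)).symm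
    exact (congrArg₂ (fun a b => tensMul m n a b) (relToTens_tensToRel φ m x)
      (relToTens_tensToRel φ n y)).symm
  -- In degree zero both rings are `R` and the bijection is the identity.
  map_one := rfl
  map_d n x := by
    -- As for products: compatibility with the differentials is inherited from `relToTens_relD`.
    apply (tensEquivRel φ (n + 1)).symm.injective
    refine ((tensEquivRel φ (n + 1)).symm_apply_apply _).trans ?_
    refine Eq.trans ?_ (relToTens_relD φ n (tensToRel φ n x)).symm
    exact (congrArg (Coring.formsD (sweedlerOne_isGrouplike φ) n)
      (relToTens_tensToRel φ n x)).symm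
  map_η _ := rfl

end Extension

end CoringForms

end

theorem mainTheorem5 {S R : Type*} [Ring S] [Ring R] (φ : S →+* R) :
    Nonempty (CoringForms.RelDGRing.Iso
      (CoringForms.sweedlerForms φ) (CoringForms.relForms φ)) :=
  ⟨CoringForms.sweedlerFormsIso φ⟩
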